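/- Let $X$ be a connected (Hausdorff) CW complex, let $P:\tilde X\to X$ be a universal covering (a surjective covering map with $\tilde X$ simply connected), and let $\pi\cong\pi_1(X)$ be its group of deck transformations. Let $X^I$ be the space of continuous paths $[0,1]\to X$ with the compact-open topology, let $\tilde X\times_\pi\tilde X$ be the quotient of $\tilde X\times\tilde X$ by the diagonal action of $\pi$, and let $$X^I\xrightarrow{\ p\ }\tilde X\times_\pi\tilde X\xrightarrow{\ q\ }X\times X,\qquad p(\gamma)=[\tilde\gamma(0),\tilde\gamma(1)],\qquad q([x,y])=(Px,Py),$$ where $\tilde\gamma$ is any lift of $\gamma$ to $\tilde X$. Define $\widetilde{\mathsf{TC}}(X)$ as the least integer $k\ge 0$ such that $X\times X$ has an open cover $U_0\cup\dots\cup U_k$ for which $p$ admits a continuous section over $q^{-1}(U_i)$ for each $i=0,\dots,k$ (and $\widetilde{\mathsf{TC}}(X)=\infty$ if there is no such $k$). Then $X$ is aspherical (that is, path-connected with $\pi_n(X)=0$ for all $n\ge 2$) if and only if $\widetilde{\mathsf{TC}}(X)=0$. Moreover, $\widetilde{\mathsf{TC}}(X)=0$ if and only if $p$ admits a continuous global section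 $\tilde X\times_\pi\tilde X\to X^I$. -/

import Mathlib

open scoped unitInterval ENat

universe u v w

/-- `P : E → X` is a universal covering: a surjective covering map with simply connected
total space. -/
structure IsUniversalCovering {X : Type u} {E : Type v} [TopologicalSpace X] [TopologicalSpace E]
    (P : E → X) : Prop where
  isCoveringMap : IsCoveringMap P
  surjective : Function.Surjective P
  simplyConnected : SimplyConnectedSpace E

/-- A path-connected space is aspherical if all its homotopy groups `π_n`, `n ≥ 2`, vanish. -/
def IsAspherical (X : Type u) [TopologicalSpace X] : Prop :=
  PathConnectedSpace X ∧ ∀ n : ℕ, 2 ≤ n → ∀ x : X, Subsingleton (HomotopyGroup.Pi n X x)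

/-- For maps `p : F → B` and `q : B → Y`, the least `k ≥ 0` such that `Y` has an open cover
`U 0, …, U k` for which `p` has a continuous section over each `q ⁻¹' (U i)`; it is `⊤` if there
is no such `k`. -/
noncomputable def secatTilde {F : Type u} {B : Type v} {Y : Type w} [TopologicalSpace F]
    [TopologicalSpace B] [TopologicalSpace Y] (p : F → B) (q : B → Y) : ℕ∞ :=
  sInf {n : ℕ∞ | ∃ k : ℕ, n = (k : ℕ∞) ∧ ∃ U : Fin (k + 1) → Set Y,
    (∀ i, IsOpen (U i)) ∧ (⋃ i, U i) = Set.univ ∧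
      ∀ i, ∃ s : C(q ⁻¹' (U i), F), ∀ b : q ⁻¹' (U i), p (s b) = b}

namespace UniversalCovering

variable {X : Type u} {E : Type v} [TopologicalSpace E]

/-- The group of deck transformations of `P`: the self-homeomorphisms `g` of `E` with
`P ∘ g = P`. For a universal covering of a connected, locally path-connected space this is the
fundamental group of the base, with its usual action on the covering space. -/
def deckGroup (P : E → X) : Subgroup (E ≃ₜ E) where
  carrier := {g | ∀ e, P (g e) = P e}
  one_mem' := fun _ => rfl
  mul_mem' := fun {a b} ha hb e => (ha (b e)).trans (hb e)
  inv_mem' := fun {a} ha e => by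
    have h := ha (a⁻¹ e)
    rw [show a (a⁻¹ e) = e from a.apply_symm_apply e] at h
    exact h.symm

instance (P : E → X) : MulAction (deckGroup P) E where
  smul g e := g.1 e
  one_smul _ := rfl
  mul_smul _ _ _ := rfl

theorem smul_def (P : E → X) (g : deckGroup P) (e : E) : g • e = g.1 e := rfl

theorem proj_smul (P : E → X) (g : deckGroup P) (e : E) : P (g • e) = P e := g.2 e

/-- The space `E ×_π E`: the quotient (with the quotient topology) of `E × E` by the diagonal
action of the deck transformation group. -/
abbrev BalancedProduct (P : E → X) : Type v :=
  Quotient (MulAction.orbitRel (deckGroup P) (E × E))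

/-- The class `[x, y]` in `E ×_π E`. -/
def BalancedProduct.mk (P : E → X) (x y : E) : BalancedProduct P :=
  Quotient.mk (MulAction.orbitRel (deckGroup P) (E × E)) (x, y)

/-- The projection `q : E ×_π E → X × X`, `[x, y] ↦ (P x, P y)`. -/
def balancedProj (P : E → X) : BalancedProduct P → X × X :=
  Quotient.lift (fun z : E × E => (P z.1, P z.2)) (by
    rintro a b ⟨g, rfl⟩
    exact Prod.ext (proj_smul P g b.1) (proj_smul P g b.2))

theorem balancedProj_mk (P : E → X) (x y : E) :
    balancedProj P (BalancedProduct.mk P x y) = (P x, P y) := rfl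

variable [TopologicalSpace X]

theorem exists_lift {P : E → X} (hP : IsUniversalCovering P) (γ : C(I, X)) :
    ∃ Γ : C(I, E), P ∘ Γ = γ := by
  obtain ⟨e, he⟩ := hP.surjective (γ 0)
  obtain ⟨Γ, h, -⟩ := hP.isCoveringMap.exists_path_lifts γ e he.symm
  exact ⟨Γ, h⟩

/-- The map `p : X^I → E ×_π E`, `p γ = [γ' 0, γ' 1]`, where `γ'` is any lift of `γ` to `E`
(see `pathProj_eq` for the independence of the lift) and `X^I = C(I, X)` carries the
compact-open topology. -/
noncomputable def pathProj {P : E → X} (hP : IsUniversalCovering P) (γ : C(I, X)) :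
    BalancedProduct P :=
  BalancedProduct.mk P ((exists_lift hP γ).choose 0) ((exists_lift hP γ).choose 1)

theorem balancedProj_pathProj {P : E → X} (hP : IsUniversalCovering P) (γ : C(I, X)) :
    balancedProj P (pathProj hP γ) = (γ 0, γ 1) := by
  have h := (exists_lift hP γ).choose_spec
  exact Prod.ext (congrFun h 0) (congrFun h 1)

theorem exists_deck {P : E → X} [LocallyPathConnectedSpace X] (hP : IsUniversalCovering P)
    {a b : E} (h : P a = P b) : ∃ g : deckGroup P, g • a = b := by
  have := hP.simplyConnected
  have hlh := hP.isCoveringMap.isLocalHomeomorph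
  have : LocallyPathConnectedSpace E := by
    choose φ hφ hφ' using hlh
    let _ : ChartedSpace X E :=
      { atlas := Set.range φ
        chartAt := φ
        mem_chart_source := hφ
        chart_mem_atlas := fun x => ⟨x, rfl⟩ }
    exact ChartedSpace.locallyPathConnectedSpace X E
  have key : ∀ c d : E, P c = P d → ∃ F : C(E, E), F c = d ∧ P ∘ F = P := fun c d hcd =>
    (hP.isCoveringMap.existsUnique_continuousMap_lifts ⟨P, hP.isCoveringMap.continuous⟩ c d
      hcd.symm).exists
  have inv : ∀ (F G : C(E, E)) (c d : E), F c = d → G d = c → P ∘ F = P → P ∘ G = P →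
      ∀ e, G (F e) = e := by
    intro F G c d hF hG hPF hPG e
    refine congrFun (hP.isCoveringMap.eq_of_comp_eq (g₁ := G ∘ F) (g₂ := id)
      (G.continuous.comp F.continuous) continuous_id ?_ c ?_) e
    · rw [← Function.comp_assoc, hPG, hPF]; rfl
    · simp [hF, hG]
  obtain ⟨F, hF, hPF⟩ := key a b h
  obtain ⟨G, hG, hPG⟩ := key b a h.symm
  exact ⟨⟨{ toFun := F, invFun := G
            left_inv := inv F G a b hF hG hPF hPG
            right_inv := inv G F b a hG hF hPG hPF
            continuous_toFun := F.continuous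
            continuous_invFun := G.continuous }, fun e => congrFun hPF e⟩, hF⟩

theorem pathProj_eq {P : E → X} [LocallyPathConnectedSpace X] (hP : IsUniversalCovering P)
    (γ : C(I, X)) (Γ : C(I, E)) (h : P ∘ Γ = γ) :
    pathProj hP γ = BalancedProduct.mk P (Γ 0) (Γ 1) := by
  have hΓ' := (exists_lift hP γ).choose_spec
  set Γ' := (exists_lift hP γ).choose with hdef
  obtain ⟨g, hg⟩ := exists_deck hP (a := Γ 0) (b := Γ' 0)
    ((congrFun h 0).trans (congrFun hΓ' 0).symm)
  have heq : ∀ t, g.1 (Γ t) = Γ' t := fun t =>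
    congrFun (hP.isCoveringMap.eq_of_comp_eq (g₁ := g.1 ∘ Γ) (g₂ := Γ')
      (g.1.continuous.comp Γ.continuous) Γ'.continuous
      (by
        rw [hΓ', ← h]
        funext s
        exact g.2 (Γ s)) 0 hg) t
  exact Quotient.sound ⟨g, Prod.ext (heq 0) (heq 1)⟩

/-- The invariant `TC~(X)`, computed with the universal covering `P : E → X`. -/
noncomputable def tcTilde {P : E → X} (hP : IsUniversalCovering P) : ℕ∞ :=
  secatTilde (pathProj hP) (balancedProj P)

end UniversalCovering

/-! Paths in `X` whose lifts run from `x` to `y` form the fibre of `pathProj` over `[x, y]`. If `X`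
is aspherical, all homotopy groups of `E` vanish (`IsUniversalCovering.subsingleton_pi`), so this
fibre has no homotopy that could obstruct a section. Since `balancedProj` is a covering of `X × X`,
a section can be built over the product cells by induction on dimension (`exists_filling`,
`exists_paths_extension`, `exists_section_over_cells`).

The difficulty is topological: the product topology on `X × X` need not be the weak topology of the
product cells, so the section obtained is only known to be continuous over products of finite unions
of closed cells. The remedy is a deformation of `X`, starting at the identity, whose end map sends a
neighborhood of each point into finitely many closed cells (`IsWeak.exists_deformation`). It lifts
to a deck-equivariant deformation of `E`. Following it from `x`, then the path chosen by the
discontinuous section, then the deformation back to `y`, yields a continuous section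
(`exists_section_of_subsingleton_pi`).

Conversely, let `s` be a section and `f` an `n`-dimensional loop with `n ≥ 2`. A lift `g` of `f` to
`E` is constant on the boundary of the cube, so the paths `s [g 0, g y]` freely deform a constant
map to `f`, following one fixed loop on the boundary. This makes `f` null-homotopic
(`GenLoop.homotopic_const_of_free`). -/

open Metric Set

/-! ### Closed unit balls and cubes. -/

/-- The radial retraction of a normed space onto its closed unit ball. -/
noncomputable def unitRetraction (V : Type*) [NormedAddCommGroup V] [NormedSpace ℝ V] :
    C(V, closedBall (0 : V) 1) where
  toFun v := ⟨(max 1 ‖v‖)⁻¹ • v, by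
    rw [mem_closedBall_zero_iff, norm_smul, norm_inv, Real.norm_of_nonneg (by positivity),
      inv_mul_le_one₀ (by positivity)]
    exact le_max_right _ _⟩
  continuous_toFun := by
    refine Continuous.subtype_mk (Continuous.smul (Continuous.inv₀ (by fun_prop) fun v => ?_)
      continuous_id) _
    positivity

theorem unitRetraction_coe {V : Type*} [NormedAddCommGroup V] [NormedSpace ℝ V]
    (v : closedBall (0 : V) 1) : unitRetraction V v = v :=
  Subtype.ext <| by
    have : ‖(v : V)‖ ≤ 1 := mem_closedBall_zero_iff.1 v.2
    simp [unitRetraction, max_eq_left this]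

/-- A retract of a normed space is a quotient of it, and local path-connectedness passes to
quotients. -/
theorem locallyPathConnectedSpace_closedBall (V : Type*) [NormedAddCommGroup V]
    [NormedSpace ℝ V] : LocallyPathConnectedSpace (closedBall (0 : V) 1) :=
  (Topology.IsQuotientMap.of_inverse continuous_subtype_val (unitRetraction V).continuous
    unitRetraction_coe).locallyPathConnectedSpace

/-- Reindexing of coordinates, as a map between closed unit cubes. -/
def cubeComp {α β : Type*} [Fintype α] [Fintype β] (e : α → β) :
    C(closedBall (0 : β → ℝ) 1, closedBall (0 : α → ℝ) 1) where
  toFun w := ⟨fun i => w.1 (e i), mem_closedBall_zero_iff.2 <|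
    (pi_norm_le_iff_of_nonneg zero_le_one).2 fun i =>
      (norm_le_pi_norm w.1 _).trans (mem_closedBall_zero_iff.1 w.2)⟩
  continuous_toFun := by
    refine Continuous.subtype_mk ?_ _
    exact continuous_pi fun i => (continuous_apply (e i)).comp continuous_subtype_val

theorem exists_cubeComp_eq {α β : Type*} [Fintype α] [Fintype β]
    (v : closedBall (0 : α → ℝ) 1) (v' : closedBall (0 : β → ℝ) 1) :
    ∃ w : closedBall (0 : α ⊕ β → ℝ) 1, cubeComp Sum.inl w = v ∧ cubeComp Sum.inr w = v' := by
  refine ⟨⟨Sum.elim v.1 v'.1, mem_closedBall_zero_iff.2 <|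
    (pi_norm_le_iff_of_nonneg zero_le_one).2 ?_⟩, rfl, rfl⟩
  rintro (i | i)
  exacts [(norm_le_pi_norm v.1 i).trans (mem_closedBall_zero_iff.1 v.2),
    (norm_le_pi_norm v'.1 i).trans (mem_closedBall_zero_iff.1 v'.2)]

/-! ### Cell systems and constructions by induction over cells. -/

/-- A decomposition of a space `B` into open cells, each of which is the injective image of the
open unit cube under a characteristic map defined on the closed unit cube, such that the boundary
of each cell is covered by finitely many closed cells of smaller dimension. No condition on the
topology of `B` is imposed. -/
structure CellSystem (B : Type u) [TopologicalSpace B] where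
  Cell : Type u
  coord : Cell → Type
  [fintypeCoord : ∀ c, Fintype (coord c)]
  char : ∀ c, C(closedBall (0 : coord c → ℝ) 1, B)
  exists_char_eq : ∀ b, ∃ c w, ‖w.1‖ < 1 ∧ char c w = b
  cell_eq : ∀ {c c' w w'}, ‖w.1‖ < 1 → ‖w'.1‖ < 1 → char c w = char c' w' → c = c'
  char_inj : ∀ {c w w'}, ‖w.1‖ < 1 → ‖w'.1‖ < 1 → char c w = char c w' → w = w'
  boundary : ∀ c, ∃ F : Finset Cell,
    (∀ c' ∈ F, Fintype.card (coord c') < Fintype.card (coord c)) ∧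
      ∀ w, ‖w.1‖ = 1 → ∃ c' ∈ F, char c w ∈ range (char c')

namespace CellSystem

attribute [instance] CellSystem.fintypeCoord

variable {B : Type u} [TopologicalSpace B] (K : CellSystem B)

/-- The dimension of a cell. -/
def dim (c : K.Cell) : ℕ := Fintype.card (K.coord c)

/-- The closed cube on which the characteristic map of a cell is defined. -/
abbrev Cube (c : K.Cell) : Type := closedBall (0 : K.coord c → ℝ) 1

theorem norm_le {c : K.Cell} (w : K.Cube c) : ‖w.1‖ ≤ 1 := mem_closedBall_zero_iff.1 w.2

/-- The dimension of the open cell containing a point. -/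
noncomputable def dimAt (b : B) : ℕ := K.dim (K.exists_char_eq b).choose

theorem dimAt_char_of_lt {c : K.Cell} {w : K.Cube c} (hw : ‖w.1‖ < 1) :
    K.dimAt (K.char c w) = K.dim c := by
  obtain ⟨w', hw', h⟩ := (K.exists_char_eq (K.char c w)).choose_spec
  exact congrArg K.dim (K.cell_eq hw' hw h)

theorem dimAt_char_le {c : K.Cell} (w : K.Cube c) : K.dimAt (K.char c w) ≤ K.dim c := by
  induction h : K.dim c using Nat.strong_induction_on generalizing c with
  | _ n ih =>
    subst h
    rcases (K.norm_le w).lt_or_eq with hw | hw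
    · exact (K.dimAt_char_of_lt hw).le
    · obtain ⟨F, hF, hF'⟩ := K.boundary c
      obtain ⟨c', hc', w', h'⟩ := hF' w hw
      rw [← h']
      exact (ih _ (hF c' hc') w' rfl).trans (hF c' hc').le

theorem dimAt_char_lt {c : K.Cell} {w : K.Cube c} (hw : ‖w.1‖ = 1) :
    K.dimAt (K.char c w) < K.dim c := by
  obtain ⟨F, hF, hF'⟩ := K.boundary c
  obtain ⟨c', hc', w', h'⟩ := hF' w hw
  rw [← h']
  exact (K.dimAt_char_le w').trans_lt (hF c' hc')

variable {Z : Type v} (q : Z → B)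

/-- The pullback of `q : Z → B` along the characteristic map of a cell. -/
abbrev Pull (c : K.Cell) : Type v := {p : K.Cube c × Z // K.char c p.1 = q p.2}

theorem exists_pull (z : Z) : ∃ (c : K.Cell) (p : K.Pull q c), ‖p.1.1.1‖ < 1 ∧ p.1.2 = z := by
  obtain ⟨c, w, hw, h⟩ := K.exists_char_eq (q z)
  exact ⟨c, ⟨(w, z), h⟩, hw, rfl⟩

variable {q} in
theorem dimAt_pull_le {c : K.Cell} (p : K.Pull q c) : K.dimAt (q p.1.2) ≤ K.dim c :=
  p.2 ▸ K.dimAt_char_le p.1.1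

/-- Functions on `Z` can be constructed by extending them over one cell at a time. -/
theorem exists_extension {V : Type w} [Nonempty V] (Q : ∀ c, (K.Pull q c → V) → Prop)
    (ext : ∀ c (f : Z → V), (∀ c', K.dim c' < K.dim c → Q c' fun p => f p.1.2) →
      ∃ G : K.Pull q c → V, (∀ p, ‖p.1.1.1‖ = 1 → G p = f p.1.2) ∧ Q c G) :
    ∃ f : Z → V, ∀ c, Q c fun p => f p.1.2 := by
  classical
  -- Stage `n` redefines the function only over the open cells of dimension `n`.
  have step : ∀ (n : ℕ) (f : Z → V), (∀ c, K.dim c < n → Q c fun p => f p.1.2) →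
      ∃ f' : Z → V, (∀ c, K.dim c < n + 1 → Q c fun p => f' p.1.2) ∧
        ∀ z, K.dimAt (q z) ≠ n → f' z = f z := by
    intro n f hf
    have hG : ∀ c, ∃ G : K.Pull q c → V, K.dim c = n →
        (∀ p, ‖p.1.1.1‖ = 1 → G p = f p.1.2) ∧ Q c G := by
      intro c
      by_cases hc : K.dim c = n
      · obtain ⟨G, hG⟩ := ext c f fun c' hc' => hf c' (hc ▸ hc')
        exact ⟨G, fun _ => hG⟩
      · exact ⟨fun p => f p.1.2, fun h => absurd h hc⟩
    choose G hG using hG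
    choose cell pt hpt hpt' using K.exists_pull q
    let f' : Z → V := fun z => if K.dimAt (q z) = n then G (cell z) (pt z) else f z
    have hf' : ∀ z, K.dimAt (q z) ≠ n → f' z = f z := fun z hz => if_neg hz
    refine ⟨f', fun c hc => ?_, hf'⟩
    rcases (Nat.lt_succ_iff.1 hc).lt_or_eq with hc | hc
    · convert hf c hc using 2 with p
      exact hf' _ ((K.dimAt_pull_le p).trans_lt hc).ne
    · convert (hG c hc).2 using 2 with p
      rcases (K.norm_le p.1.1).lt_or_eq with hp | hp
      · have h1 : K.dimAt (q p.1.2) = n := by rw [← p.2, K.dimAt_char_of_lt hp, hc]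
        have h2 : f' p.1.2 = G (cell p.1.2) (pt p.1.2) := if_pos h1
        rw [h2]
        -- The chosen cell and the given one contain the same point in their interiors, hence
        -- coincide. Generalizing the choice allows the equality of cells to be substituted.
        have h3 : K.char (cell p.1.2) (pt p.1.2).1.1 = K.char c p.1.1 := by
          rw [(pt p.1.2).2, hpt', p.2]
        have h4 := hpt p.1.2
        have h5 := hpt' p.1.2
        generalize pt p.1.2 = p' at h3 h4 h5
        generalize cell p.1.2 = c' at p' h3 h4 h5
        obtain rfl := K.cell_eq h4 hp h3
        congr 1
        exact Subtype.ext (Prod.ext (K.char_inj h4 hp h3) h5)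
      · rw [(hG c hc).1 p hp, hf' _ ?_]
        rw [← p.2, ← hc]
        exact (K.dimAt_char_lt hp).ne
  choose! next hnext hnext' using step
  -- `F n` is correct over the cells of dimension less than `n`; its value at `z` no longer changes
  -- from stage `dimAt (q z) + 1` on.
  let F : ℕ → Z → V := fun n => Nat.rec (fun _ => Classical.arbitrary V) next n
  have hF : ∀ n, ∀ c, K.dim c < n → Q c fun p => F n p.1.2 := by
    intro n
    induction n with
    | zero => exact fun c hc => absurd hc (Nat.not_lt_zero _)
    | succ n ih => exact hnext n (F n) ih
  have hFs : ∀ z n, F (K.dimAt (q z) + 1 + n) z = F (K.dimAt (q z) + 1) z := by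
    intro z n
    induction n with
    | zero => rfl
    | succ n ih =>
      rw [← ih]
      exact hnext' _ (F _) (hF _) z (by lia)
  refine ⟨fun z => F (K.dimAt (q z) + 1) z, fun c => ?_⟩
  convert hF (K.dim c + 1) c (Nat.lt_succ_self _) using 2 with p
  obtain ⟨k, hk⟩ := Nat.exists_eq_add_of_le (K.dimAt_pull_le p)
  rw [hk, add_right_comm, hFs]

variable {q} [TopologicalSpace Z]

/-- The pullback is closed in `Cube × Z` because `B` is Hausdorff, and the projection to `Z` is
closed because the cube is compact. So closed sets upstairs have closed images. -/
theorem continuousOn_closedCell [T2Space B] (hq : Continuous q) {Y : Type w} [TopologicalSpace Y]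
    {f : Z → Y} {c : K.Cell} (hf : Continuous fun p : K.Pull q c => f p.1.2) :
    ContinuousOn f (q ⁻¹' range (K.char c)) := by
  have hcl : IsClosed {p : K.Cube c × Z | K.char c p.1 = q p.2} :=
    isClosed_eq (by fun_prop) (by fun_prop)
  rw [continuousOn_iff_isClosed]
  intro t ht
  refine ⟨_, isClosedMap_snd_of_compactSpace _
    (hcl.isClosedEmbedding_subtypeVal.isClosedMap _ (ht.preimage hf)), ?_⟩
  ext z
  constructor
  · rintro ⟨hz, w, hw⟩
    exact ⟨⟨(w, z), ⟨⟨(w, z), hw⟩, hz, rfl⟩, rfl⟩, w, hw⟩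
  · rintro ⟨⟨_, ⟨p, hp, rfl⟩, rfl⟩, hz⟩
    exact ⟨hp, hz⟩

theorem isClosed_range_char [T2Space B] (c : K.Cell) : IsClosed (range (K.char c)) :=
  (isCompact_range (K.char c).continuous).isClosed

theorem continuousOn_finite [T2Space B] (hq : Continuous q) {Y : Type w} [TopologicalSpace Y]
    {f : Z → Y} (F : Finset K.Cell)
    (hf : ∀ c ∈ F, Continuous fun p : K.Pull q c => f p.1.2) :
    ContinuousOn f (q ⁻¹' ⋃ c ∈ F, range (K.char c)) := by
  classical
  induction F using Finset.induction_on with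
  | empty => simp
  | insert c F _ ih =>
    rw [Finset.set_biUnion_insert, preimage_union]
    refine ContinuousOn.union_of_isClosed (K.continuousOn_closedCell hq (hf c (by simp)))
      (ih fun c' hc' => hf c' (by simp [hc'])) ((K.isClosed_range_char c).preimage hq) ?_
    exact (isClosed_biUnion_finset fun c _ => K.isClosed_range_char c).preimage hq

theorem continuousOn_boundary [T2Space B] (hq : Continuous q) {Y : Type w} [TopologicalSpace Y]
    {f : Z → Y} {c : K.Cell}
    (hf : ∀ c', K.dim c' < K.dim c → Continuous fun p : K.Pull q c' => f p.1.2) :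
    ContinuousOn f (q ⁻¹' (K.char c '' {w | ‖w.1‖ = 1})) := by
  obtain ⟨F, hF, hF'⟩ := K.boundary c
  refine (K.continuousOn_finite hq F fun c' hc' => hf c' (hF c' hc')).mono ?_
  rintro z ⟨w, hw, h⟩
  obtain ⟨c', hc', h'⟩ := hF' w hw
  exact mem_iUnion₂.2 ⟨c', hc', h ▸ h'⟩

/-- Functions on `B` can be constructed by extending them over one cell at a time. -/
theorem exists_extension_id {V : Type w} [Nonempty V] (Q : ∀ c, (K.Cube c → V) → Prop)
    (ext : ∀ c (f : B → V), (∀ c', K.dim c' < K.dim c → Q c' fun w => f (K.char c' w)) →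
      ∃ G : K.Cube c → V, (∀ w, ‖w.1‖ = 1 → G w = f (K.char c w)) ∧ Q c G) :
    ∃ f : B → V, ∀ c, Q c fun w => f (K.char c w) := by
  refine K.exists_extension id (fun c G => Q c fun w => G ⟨(w, K.char c w), rfl⟩) fun c f hf => ?_
  obtain ⟨G, hG, hQ⟩ := ext c f hf
  refine ⟨fun p => G p.1.1, fun p hp => ?_, hQ⟩
  exact (hG _ hp).trans (congrArg f p.2)

theorem continuous_pull_id {Y : Type w} [TopologicalSpace Y] {f : B → Y} {c : K.Cell}
    (hf : Continuous fun w => f (K.char c w)) :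
    Continuous fun p : K.Pull (id : B → B) c => f p.1.2 := by
  have : (fun p : K.Pull (id : B → B) c => f p.1.2) = fun p => f (K.char c p.1.1) := by
    funext p
    exact congrArg f p.2.symm
  rw [this]
  exact hf.comp (by fun_prop)

theorem continuousOn_boundary_id [T2Space B] {Y : Type w} [TopologicalSpace Y]
    {f : B → Y} {c : K.Cell}
    (hf : ∀ c', K.dim c' < K.dim c → Continuous fun w => f (K.char c' w)) :
    ContinuousOn f (K.char c '' {w | ‖w.1‖ = 1}) :=
  K.continuousOn_boundary continuous_id fun c' hc' => K.continuous_pull_id (hf c' hc')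

/-- The topology of `B` is the weak topology determined by the closed cells. -/
def IsWeak : Prop :=
  ∀ A : Set B, (∀ c, IsClosed (K.char c ⁻¹' A)) → IsClosed A

variable {K} in
theorem IsWeak.continuous (hK : K.IsWeak) {Y : Type w} [TopologicalSpace Y] {f : B → Y}
    (hf : ∀ c, Continuous fun w => f (K.char c w)) : Continuous f :=
  continuous_iff_isClosed.2 fun _ ht => hK _ fun c => ht.preimage (hf c)

variable {K} in
-- The weak topology makes `B` a quotient of the disjoint union of its closed cubes.
theorem IsWeak.locallyPathConnectedSpace (hK : K.IsWeak) : LocallyPathConnectedSpace B := by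
  have (c : K.Cell) : LocallyPathConnectedSpace (K.Cube c) :=
    locallyPathConnectedSpace_closedBall _
  let m : (Σ c, K.Cube c) → B := fun p => K.char p.1 p.2
  have hm : Topology.IsQuotientMap m := by
    rw [Topology.isQuotientMap_iff_isClosed]
    refine ⟨fun b => ?_, fun A => ⟨fun hA => hA.preimage ?_, fun hA => hK A fun c => ?_⟩⟩
    · obtain ⟨c, w, -, h⟩ := K.exists_char_eq b
      exact ⟨⟨c, w⟩, h⟩
    · exact continuous_sigma fun c => (K.char c).continuous
    · exact hA.preimage continuous_sigmaMk
  exact hm.locallyPathConnectedSpace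

/-! ### Products of cell systems, and CW complexes. -/

/-- The product of two cell systems. -/
def prod {B' : Type u} [TopologicalSpace B'] (K' : CellSystem B') : CellSystem (B × B') where
  Cell := K.Cell × K'.Cell
  coord c := K.coord c.1 ⊕ K'.coord c.2
  char c := ((K.char c.1).comp (cubeComp Sum.inl)).prodMk ((K'.char c.2).comp (cubeComp Sum.inr))
  exists_char_eq := by
    rintro ⟨b, b'⟩
    obtain ⟨c, w, hw, rfl⟩ := K.exists_char_eq b
    obtain ⟨c', w', hw', rfl⟩ := K'.exists_char_eq b'
    have : ‖(Sum.elim w.1 w'.1 : _ → ℝ)‖ < 1 := by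
      rw [pi_norm_lt_iff zero_lt_one] at hw hw' ⊢
      rintro (i | i)
      exacts [hw i, hw' i]
    exact ⟨(c, c'), ⟨_, mem_closedBall_zero_iff.2 this.le⟩, this, rfl⟩
  cell_eq := by
    intro c c' w w' hw hw' h
    rw [pi_norm_lt_iff zero_lt_one] at hw hw'
    have h1 := (Prod.ext_iff.1 h).1
    have h2 := (Prod.ext_iff.1 h).2
    exact Prod.ext
      (K.cell_eq ((pi_norm_lt_iff zero_lt_one).2 fun i => hw (.inl i))
        ((pi_norm_lt_iff zero_lt_one).2 fun i => hw' (.inl i)) h1)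
      (K'.cell_eq ((pi_norm_lt_iff zero_lt_one).2 fun i => hw (.inr i))
        ((pi_norm_lt_iff zero_lt_one).2 fun i => hw' (.inr i)) h2)
  char_inj := by
    intro c w w' hw hw' h
    rw [pi_norm_lt_iff zero_lt_one] at hw hw'
    have h1 := congrArg Subtype.val
      (K.char_inj ((pi_norm_lt_iff zero_lt_one).2 fun i => hw (.inl i))
        ((pi_norm_lt_iff zero_lt_one).2 fun i => hw' (.inl i)) (Prod.ext_iff.1 h).1)
    have h2 := congrArg Subtype.val
      (K'.char_inj ((pi_norm_lt_iff zero_lt_one).2 fun i => hw (.inr i))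
        ((pi_norm_lt_iff zero_lt_one).2 fun i => hw' (.inr i)) (Prod.ext_iff.1 h).2)
    refine Subtype.ext (funext ?_)
    rintro (i | i)
    exacts [congrFun h1 i, congrFun h2 i]
  boundary := by
    classical
    rintro ⟨c, c'⟩
    obtain ⟨F, hF, hFw⟩ := K.boundary c
    obtain ⟨F', hF', hFw'⟩ := K'.boundary c'
    -- The boundary of a product of cubes is the union of boundary times cube and cube times
    -- boundary.
    refine ⟨F ×ˢ {c'} ∪ {c} ×ˢ F', ?_, fun w hw => ?_⟩
    · rintro ⟨d, d'⟩ hd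
      simp only [Finset.mem_union, Finset.mem_product, Finset.mem_singleton] at hd
      simp only [Fintype.card_sum]
      rcases hd with ⟨hd, rfl⟩ | ⟨rfl, hd⟩
      · have := hF d hd
        lia
      · have := hF' d' hd
        lia
    · set w₁ : K.Cube c := cubeComp Sum.inl w
      set w₂ : K'.Cube c' := cubeComp Sum.inr w
      have key : ∀ (d : K.Cell) (d' : K'.Cell), K.char c w₁ ∈ range (K.char d) →
          K'.char c' w₂ ∈ range (K'.char d') → ∃ v : closedBall (0 : K.coord d ⊕ K'.coord d' → ℝ) 1,
            (K.char d (cubeComp Sum.inl v), K'.char d' (cubeComp Sum.inr v)) =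
            (K.char c w₁, K'.char c' w₂) := by
        rintro d d' ⟨v, hv⟩ ⟨v', hv'⟩
        obtain ⟨w, h, h'⟩ := exists_cubeComp_eq v v'
        exact ⟨w, by rw [h, h', hv, hv']⟩
      rcases (K.norm_le w₁).lt_or_eq with h₁ | h₁
      · rcases (K'.norm_le w₂).lt_or_eq with h₂ | h₂
        · refine absurd hw (ne_of_lt ((pi_norm_lt_iff zero_lt_one).2 ?_))
          rw [pi_norm_lt_iff zero_lt_one] at h₁ h₂
          rintro (i | i)
          exacts [h₁ i, h₂ i]
        · obtain ⟨d', hd', h⟩ := hFw' w₂ h₂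
          exact ⟨(c, d'), by simp [hd'], key c d' ⟨w₁, rfl⟩ h⟩
      · obtain ⟨d, hd, h⟩ := hFw w₁ h₁
        exact ⟨(d, c'), by simp [hd], key d c' h ⟨w₂, rfl⟩⟩

/-- The cell system of a CW complex. -/
noncomputable def ofCWComplex (X : Type u) [TopologicalSpace X]
    [Topology.CWComplex (univ : Set X)] : CellSystem X where
  Cell := Σ n, Topology.CWComplex.cell (univ : Set X) n
  coord c := Fin c.1
  char c := ⟨(closedBall 0 1).domRestrict (Topology.CWComplex.map c.1 c.2),
    (Topology.CWComplex.continuousOn c.1 c.2).domRestrict⟩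
  exists_char_eq b := by
    have hb := mem_univ b
    rw [← Topology.CWComplex.iUnion_openCell_eq_complex (C := (univ : Set X))] at hb
    obtain ⟨n, j, w, hw, rfl⟩ := mem_iUnion₂.1 hb
    exact ⟨⟨n, j⟩, ⟨w, ball_subset_closedBall hw⟩, mem_ball_zero_iff.1 hw, rfl⟩
  cell_eq := by
    intro c c' w w' hw hw' h
    by_contra hne
    exact disjoint_left.1 (Topology.CWComplex.disjoint_openCell_of_ne (C := (univ : Set X))
      (n := c.1) (i := c.2) (m := c'.1) (j := c'.2) hne)
      ⟨w.1, mem_ball_zero_iff.2 hw, rfl⟩ ⟨w'.1, mem_ball_zero_iff.2 hw', h.symm⟩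
  char_inj := by
    intro c w w' hw hw' h
    refine Subtype.ext ((Topology.CWComplex.map c.1 c.2).injOn ?_ ?_ h)
    · rw [Topology.CWComplex.source_eq]
      exact mem_ball_zero_iff.2 hw
    · rw [Topology.CWComplex.source_eq]
      exact mem_ball_zero_iff.2 hw'
  boundary := by
    classical
    rintro ⟨n, i⟩
    obtain ⟨J, hJ⟩ := Topology.CWComplex.mapsTo (C := (univ : Set X)) n i
    refine ⟨(Finset.range n).sigma J, fun c' hc' => ?_, fun w hw => ?_⟩
    · simpa using (Finset.mem_sigma.1 hc').1
    · have := hJ (mem_sphere_zero_iff_norm.2 hw)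
      simp only [mem_iUnion] at this
      obtain ⟨m, hm, j, hj, v, hv, h⟩ := this
      exact ⟨⟨m, j⟩, by simp [hm, hj], ⟨v, hv⟩, h⟩

theorem isWeak_ofCWComplex (X : Type u) [TopologicalSpace X] [T2Space X]
    [Topology.CWComplex (univ : Set X)] : (ofCWComplex X).IsWeak := by
  intro A hA
  rw [Topology.CWComplex.closed (univ : Set X) A (subset_univ A)]
  intro n j
  have := ((hA ⟨n, j⟩).isCompact.image ((ofCWComplex X).char ⟨n, j⟩).continuous).isClosed
  convert this using 1
  ext x
  constructor
  · rintro ⟨hx, w, hw, rfl⟩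
    exact ⟨⟨w, hw⟩, hx, rfl⟩
  · rintro ⟨w, hx, rfl⟩
    exact ⟨hx, w.1, w.2, rfl⟩

theorem mem_range_prod_char {B' : Type u} [TopologicalSpace B'] {K' : CellSystem B'} {c : K.Cell}
    {c' : K'.Cell} {b : B × B'} (h : b.1 ∈ range (K.char c)) (h' : b.2 ∈ range (K'.char c')) :
    b ∈ range ((K.prod K').char (c, c')) := by
  obtain ⟨v, hv⟩ := h
  obtain ⟨v', hv'⟩ := h'
  obtain ⟨w, rfl, rfl⟩ := exists_cubeComp_eq v v'
  exact ⟨w, Prod.ext hv hv'⟩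

end CellSystem

/-! ### Deforming a complex locally into finite unions of closed cells. -/

section unitRetraction

variable {V : Type*} [NormedAddCommGroup V] [NormedSpace ℝ V]

theorem unitRetraction_val_of_one_le {v : V} (hv : 1 ≤ ‖v‖) :
    (unitRetraction V v : V) = ‖v‖⁻¹ • v := by
  simp [unitRetraction, max_eq_right hv]

theorem norm_unitRetraction {v : V} (hv : 1 ≤ ‖v‖) : ‖(unitRetraction V v : V)‖ = 1 := by
  rw [unitRetraction_val_of_one_le hv, norm_smul, norm_inv, norm_norm, inv_mul_cancel₀]
  positivity

theorem unitRetraction_smul {s : ℝ} (hs : 1 ≤ s) {w : closedBall (0 : V) 1}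
    (hw : ‖w.1‖ = 1) : unitRetraction V (s • w.1) = w := by
  have h : ‖s • w.1‖ = s := by rw [norm_smul, hw, Real.norm_of_nonneg (by positivity), mul_one]
  refine Subtype.ext ?_
  rw [unitRetraction_val_of_one_le (by rwa [h]), h, inv_smul_smul₀ (by positivity)]

end unitRetraction

namespace CellSystem

variable {B : Type u} [TopologicalSpace B] (K : CellSystem B)

/-- The map from a closed cube to itself that doubles all vectors and then retracts radially. Outside
the open cube of half the size, it is the radial projection to the boundary. -/
noncomputable def push (c : K.Cell) : C(K.Cube c, K.Cube c) :=
  (unitRetraction (K.coord c → ℝ)).comp ⟨fun w => (2 : ℝ) • w.1, by fun_prop⟩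

variable {K}

theorem norm_push {c : K.Cell} {w : K.Cube c} (hw : 1 / 2 ≤ ‖w.1‖) : ‖(K.push c w).1‖ = 1 := by
  refine norm_unitRetraction (v := (2 : ℝ) • w.1) ?_
  rw [norm_smul, Real.norm_of_nonneg zero_le_two]
  linarith

theorem push_val {c : K.Cell} {w : K.Cube c} (hw : 1 / 2 ≤ ‖w.1‖) :
    (K.push c w).1 = ‖w.1‖⁻¹ • w.1 := by
  have h : ‖(2 : ℝ) • w.1‖ = 2 * ‖w.1‖ := by rw [norm_smul, Real.norm_of_nonneg zero_le_two]
  have := unitRetraction_val_of_one_le (v := (2 : ℝ) • w.1) (by rw [h]; linarith)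
  rw [h, smul_smul] at this
  refine this.trans ?_
  congr 1
  have : ‖w.1‖ ≠ 0 := by linarith
  field_simp

theorem push_eq_self {c : K.Cell} {w : K.Cube c} (hw : ‖w.1‖ = 1) : K.push c w = w :=
  unitRetraction_smul one_le_two hw

variable (K) in
/-- The union of finitely many closed cells. -/
def closedCells (F : Finset K.Cell) : Set B := ⋃ c ∈ F, range (K.char c)

theorem closedCells_mono {F F' : Finset K.Cell} (h : F ⊆ F') :
    K.closedCells F ⊆ K.closedCells F' :=
  biUnion_subset_biUnion_left h

/-- The conditions on a homotopy of `B` over a single cell: it starts with the inclusion, its end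
is radially constant near the boundary, and it takes place in finitely many closed cells. -/
structure IsPushing {c : K.Cell} (G : K.Cube c → C(I, B)) : Prop where
  continuous : Continuous G
  zero : ∀ w, G w 0 = K.char c w
  one : ∀ w, 1 / 2 ≤ ‖w.1‖ → G w 1 = G (K.push c w) 1
  finite : ∃ F, ∀ w t, G w t ∈ K.closedCells F

-- Attach to the cube an outer collar of radii between `1` and `2` on which the homotopy `f` of the
-- boundary runs, with radius minus `1` as time. Stretching the cube radially onto the cube with
-- collar extends the homotopy. At the end everything of radius at least `1 / 2` sits at radius `2`,
-- which gives the radial constancy.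
open Classical in
theorem exists_isPushing_extension [T2Space B] (c : K.Cell) (f : B → C(I, B))
    (hf : ∀ c', K.dim c' < K.dim c → K.IsPushing fun w => f (K.char c' w)) :
    ∃ G : K.Cube c → C(I, B), (∀ w, ‖w.1‖ = 1 → G w = f (K.char c w)) ∧ K.IsPushing G := by
  obtain ⟨F, hF, hFw⟩ := K.boundary c
  have hf0 : ∀ w : K.Cube c, ‖w.1‖ = 1 → f (K.char c w) 0 = K.char c w := by
    intro w hw
    obtain ⟨c', hc', w', hw'⟩ := hFw w hw
    rw [← hw']
    exact (hf c' (hF c' hc')).zero w'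
  let V := K.coord c → ℝ
  let C : V → B := fun v => if ‖v‖ ≤ 1 then K.char c (unitRetraction V v) else
    f (K.char c (unitRetraction V v)) (projIcc 0 1 zero_le_one (‖v‖ - 1))
  have hC1 : ∀ v : K.Cube c, C v.1 = K.char c v := fun v => by
    rw [show C v.1 = _ from if_pos (K.norm_le v), unitRetraction_coe]
  have hC2 : ∀ v, 1 ≤ ‖v‖ →
      C v = f (K.char c (unitRetraction V v)) (projIcc 0 1 zero_le_one (‖v‖ - 1)) := by
    intro v hv
    rcases hv.eq_or_lt with h | h
    · rw [show C v = _ from if_pos h.ge, ← h, sub_self, projIcc_left]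
      exact (hf0 _ (norm_unitRetraction hv)).symm
    · exact if_neg h.not_ge
  have hCc : Continuous C := by
    refine continuous_if_le continuous_norm continuous_const
      ((K.char c).comp (unitRetraction V)).continuous.continuousOn ?_ fun v hv => ?_
    · have h1 : ContinuousOn (fun v => f (K.char c (unitRetraction V v))) {v : V | 1 ≤ ‖v‖} := by
        refine (K.continuousOn_boundary_id fun c' hc' => (hf c' hc').continuous).comp
          ((K.char c).comp (unitRetraction V)).continuous.continuousOn ?_
        exact fun v hv => ⟨_, norm_unitRetraction hv, rfl⟩
      have h2 : Continuous fun v : V => projIcc (0 : ℝ) 1 zero_le_one (‖v‖ - 1) :=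
        continuous_projIcc.comp (by fun_prop)
      exact continuous_eval.comp_continuousOn (h1.prodMk h2.continuousOn)
    · rw [← hC2 v hv.ge, show C v = _ from if_pos hv.le]
  -- The scaling factor moves linearly from `1` to `2 / max ‖w‖ (1 / 2)`; on the boundary it is `1 +
  -- t`, so the time parameter of `f` there is exactly `t`.
  let s : K.Cube c × I → V := fun p =>
    ((1 - p.2 : ℝ) + p.2 * (2 / max ‖p.1.1‖ (1 / 2))) • p.1.1
  have hs : Continuous s := by
    have h1 : Continuous fun p : K.Cube c × I => 2 / max ‖p.1.1‖ (1 / 2) := by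
      refine continuous_const.div (by fun_prop) fun p => ?_
      have : (0 : ℝ) < max ‖p.1.1‖ (1 / 2) := lt_max_of_lt_right (by norm_num)
      exact this.ne'
    fun_prop
  have hs1 : ∀ w : K.Cube c, 1 / 2 ≤ ‖w.1‖ → s (w, 1) = (2 : ℝ) • (K.push c w).1 := by
    intro w hw
    simp only [s]
    rw [push_val hw, max_eq_left hw, smul_smul]
    simp [div_eq_mul_inv]
  have hs2 : ∀ (w : K.Cube c) t, ‖w.1‖ = 1 → s (w, t) = (1 + t : ℝ) • w.1 := by
    intro w t hw
    simp only [s, hw]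
    congr 1
    rw [max_eq_left (by norm_num)]
    ring
  let G : C(K.Cube c, C(I, B)) := ContinuousMap.curry ⟨fun p => C (s p), hCc.comp hs⟩
  refine ⟨G, fun w hw => ?_, G.continuous, fun w => ?_, fun w hw => ?_, ?_⟩
  · ext t
    change C (s (w, t)) = _
    have h1 : (1 : ℝ) ≤ 1 + t := by linarith [t.2.1]
    have h2 : ‖(1 + t : ℝ) • w.1‖ = 1 + t := by
      rw [norm_smul, hw, mul_one, Real.norm_of_nonneg (by linarith)]
    rw [hs2 w t hw, hC2 _ (h1.trans_eq h2.symm), h2, unitRetraction_smul h1 hw, add_sub_cancel_left,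
      projIcc_val]
  · change C (s (w, 0)) = _
    simp [s, hC1]
  · change C (s (w, 1)) = C (s (K.push c w, 1))
    have h := norm_push hw
    rw [hs1 w hw, hs2 _ _ h]
    norm_num
  · have hF' : ∀ c', ∃ F', K.dim c' < K.dim c → ∀ w t, f (K.char c' w) t ∈ K.closedCells F' := by
      intro c'
      by_cases hc' : K.dim c' < K.dim c
      · exact (hf c' hc').finite.imp fun F' h _ => h
      · exact ⟨∅, fun h => absurd h hc'⟩
    choose J hJ using hF'
    refine ⟨insert c (F.biUnion J), fun w t => ?_⟩
    change C (s (w, t)) ∈ _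
    rcases le_total ‖s (w, t)‖ 1 with h | h
    · have := hC1 ⟨s (w, t), mem_closedBall_zero_iff.2 h⟩
      rw [this]
      exact mem_iUnion₂.2 ⟨c, by simp, mem_range_self _⟩
    · rw [hC2 _ h]
      obtain ⟨c', hc', w', hw'⟩ := hFw _ (norm_unitRetraction h)
      rw [← hw']
      refine closedCells_mono ?_ (hJ c' (hF c' hc') w' _)
      exact (Finset.subset_biUnion_of_mem J hc').trans (Finset.subset_insert _ _)

/-- A space with the weak topology determined by a cell system can be deformed such that in the
end each point has a neighborhood mapped to finitely many closed cells. -/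
theorem IsWeak.exists_deformation [T2Space B] [Nonempty B] (hK : K.IsWeak) :
    ∃ h : C(B, C(I, B)), (∀ x, h x 0 = x) ∧
      ∀ x, ∃ U, IsOpen U ∧ x ∈ U ∧ ∃ F, ∀ y ∈ U, h y 1 ∈ K.closedCells F := by
  have : Nonempty C(I, B) := ⟨.const I (Classical.arbitrary B)⟩
  obtain ⟨h, hh⟩ := K.exists_extension_id (fun _ G => K.IsPushing G) exists_isPushing_extension
  refine ⟨⟨h, hK.continuous fun c => (hh c).continuous⟩, fun x => ?_, fun x => ?_⟩
  · obtain ⟨c, w, -, rfl⟩ := K.exists_char_eq x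
    exact (hh c).zero w
  obtain ⟨c₀, w₀, hw₀, rfl⟩ := K.exists_char_eq x
  obtain ⟨F, hF⟩ := (hh c₀).finite
  -- An open set is a continuous map to `Prop`, so the neighborhood too is built cell by cell. It
  -- starts with the whole interior of `c₀` and is thickened radially into the outer half of each
  -- cell; there the end map factors through the boundary, so it stays in the same finite union.
  obtain ⟨U, hU⟩ := K.exists_extension_id (V := Prop)
    (fun c G => Continuous G ∧ (∀ w, G w → h (K.char c w) 1 ∈ K.closedCells F) ∧
      (c = c₀ → ∀ w, ‖w.1‖ < 1 → G w)) <| by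
    intro c f hf
    refine ⟨fun w => (c = c₀ ∧ ‖w.1‖ < 1) ∨ (1 / 2 < ‖w.1‖ ∧ f (K.char c (K.push c w))),
      fun w hw => ?_, ?_, fun w hw => ?_, fun hc w hw => .inl ⟨hc, hw⟩⟩
    · beta_reduce
      rw [push_eq_self hw, hw]
      norm_num
    · have h0 : IsOpen {w : K.Cube c | c = c₀ ∧ ‖w.1‖ < 1} :=
        isOpen_const.inter (isOpen_lt (f := fun w : K.Cube c => ‖w.1‖) (by fun_prop) continuous_const)
      have h1 : IsOpen {w : K.Cube c | 1 / 2 < ‖w.1‖} := isOpen_lt continuous_const (by fun_prop)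
      have h2 : ContinuousOn (fun w => f (K.char c (K.push c w)))
          {w : K.Cube c | 1 / 2 < ‖w.1‖} :=
        (K.continuousOn_boundary_id fun c' hc' => (hf c' hc').1).comp
          ((K.char c).comp (K.push c)).continuous.continuousOn
          fun w hw => ⟨_, norm_push (le_of_lt hw), rfl⟩
      refine continuous_Prop.2 ?_
      convert h0.union (h2.isOpen_inter_preimage h1 isOpen_singleton_true) using 1
      ext w
      simp
    · rcases hw with ⟨rfl, -⟩ | ⟨hw, hfw⟩
      · exact hF w 1
      · rw [(hh c).one w hw.le]
        obtain ⟨F', hF', hFw'⟩ := K.boundary c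
        obtain ⟨c', hc', w', hw'⟩ := hFw' _ (norm_push hw.le)
        rw [← hw'] at hfw ⊢
        exact (hf c' (hF' c' hc')).2.1 w' hfw
  refine ⟨{x | U x}, continuous_Prop.1 (hK.continuous fun c => (hU c).1),
    (hU c₀).2.2 rfl w₀ hw₀, F, fun y hy => ?_⟩
  obtain ⟨c, w, -, rfl⟩ := K.exists_char_eq y
  exact (hU c).2.1 w hy

end CellSystem

/-! ### From cubes with collapsed boundary to spheres. -/

section Collapse

variable {V : Type*} [NormedAddCommGroup V] [NormedSpace ℝ V]

/-- The scaling factor of the first component of `collapse`. -/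
noncomputable def collapseScale (r : ℝ) : ℝ := min 1 (3 * (1 - r)) / max r (1 / 3)

/-- The second component of `collapse`. -/
noncomputable def collapseHeight (r : ℝ) : ℝ := max (-1) (min 1 (6 * r - 3))

/-- A map from the closed unit ball of `V` onto the unit sphere of `V × ℝ` that is injective on
the open ball and maps the boundary to the north pole. -/
noncomputable def collapse (v : V) : V × ℝ := (collapseScale ‖v‖ • v, collapseHeight ‖v‖)

theorem continuous_collapse : Continuous (collapse : V → V × ℝ) := by
  have h : Continuous fun v : V => collapseScale ‖v‖ := by
    refine Continuous.div (by fun_prop) (by fun_prop) fun v => ?_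
    have : (0 : ℝ) < max ‖v‖ (1 / 3) := lt_max_of_lt_right (by norm_num)
    exact this.ne'
  refine (h.smul continuous_id).prodMk ?_
  unfold collapseHeight
  fun_prop

theorem collapseScale_of_le {r : ℝ} (h : r ≤ 1 / 3) : collapseScale r = 3 := by
  rw [collapseScale, min_eq_left (by linarith), max_eq_right h]
  norm_num

theorem collapseScale_of_mem {r : ℝ} (h : 1 / 3 ≤ r) (h' : r ≤ 2 / 3) :
    collapseScale r = r⁻¹ := by
  rw [collapseScale, min_eq_left (by linarith), max_eq_left h, one_div]

theorem collapseScale_of_ge {r : ℝ} (h : 2 / 3 ≤ r) :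
    collapseScale r = 3 * (1 - r) / r := by
  rw [collapseScale, min_eq_right (by linarith), max_eq_left (by linarith)]

theorem collapseHeight_of_le {r : ℝ} (h : r ≤ 1 / 3) : collapseHeight r = -1 := by
  rw [collapseHeight, min_eq_right (by linarith), max_eq_left (by linarith)]

theorem collapseHeight_of_mem {r : ℝ} (h : 1 / 3 ≤ r) (h' : r ≤ 2 / 3) :
    collapseHeight r = 6 * r - 3 := by
  rw [collapseHeight, min_eq_right (by linarith), max_eq_right (by linarith)]

theorem collapseHeight_of_ge {r : ℝ} (h : 2 / 3 ≤ r) : collapseHeight r = 1 := by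
  rw [collapseHeight, min_eq_left (by linarith), max_eq_right (by linarith)]

/-- The unit sphere of `V × ℝ` is the surface of a cylinder. Radii up to `1 / 3` fill the bottom,
radii between `1 / 3` and `2 / 3` the lateral wall, and larger radii the top, shrinking to its
center at radius `1`. -/
theorem norm_collapse {v : V} (hv : ‖v‖ ≤ 1) : ‖collapse v‖ = 1 := by
  rw [collapse, Prod.norm_mk, norm_smul, Real.norm_eq_abs, Real.norm_eq_abs]
  have h0 := norm_nonneg v
  generalize ‖v‖ = r at hv h0
  rcases le_total r (1 / 3) with h | h
  · rw [collapseScale_of_le h, collapseHeight_of_le h, abs_of_nonneg (by norm_num), abs_neg,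
      abs_one, max_eq_right (by linarith)]
  rcases le_total r (2 / 3) with h' | h'
  · rw [collapseScale_of_mem h h', collapseHeight_of_mem h h', abs_of_nonneg (by positivity),
      inv_mul_cancel₀ (by linarith), max_eq_left (abs_le.2 ⟨by linarith, by linarith⟩)]
  · rw [collapseScale_of_ge h', collapseHeight_of_ge h', abs_one,
      abs_of_nonneg (div_nonneg (by linarith) h0), div_mul_cancel₀ _ (by linarith),
      max_eq_right (by linarith)]

theorem collapse_of_norm_eq_one {v : V} (hv : ‖v‖ = 1) : collapse v = (0, 1) := by
  rw [collapse, hv, collapseScale_of_ge (by norm_num), collapseHeight_of_ge (by norm_num)]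
  simp

/-- The height tells bottom, wall and top apart and fixes the radius on the wall; on the top the
norm of the first component fixes it. With equal nonzero scaling factors the vectors agree, and the
factor vanishes only at radius `1`. -/
theorem collapse_inj {v v' : V} (hv : ‖v‖ ≤ 1) (hv' : ‖v'‖ ≤ 1) (h : collapse v = collapse v') :
    v = v' ∨ (‖v‖ = 1 ∧ ‖v'‖ = 1) := by
  have h1 : collapseScale ‖v‖ • v = collapseScale ‖v'‖ • v' := (Prod.ext_iff.1 h).1
  have h2 : collapseHeight ‖v‖ = collapseHeight ‖v'‖ := (Prod.ext_iff.1 h).2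
  have key : collapseScale ‖v‖ = collapseScale ‖v'‖ → collapseScale ‖v‖ ≠ 0 → v = v' := by
    intro e e'
    rw [← e] at h1
    exact smul_right_injective V e' h1
  have h3 : collapseScale ‖v‖ * ‖v‖ = collapseScale ‖v'‖ * ‖v'‖ := by
    have := congrArg norm h1
    have hs : ∀ r : ℝ, r ≤ 1 → 0 ≤ collapseScale r := fun r hr =>
      div_nonneg (le_min zero_le_one (by linarith)) (le_max_of_le_right (by norm_num))
    rwa [norm_smul, norm_smul, Real.norm_of_nonneg (hs _ hv), Real.norm_of_nonneg (hs _ hv')]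
      at this
  rcases le_or_gt ‖v‖ (1 / 3) with hr | hr
  · rcases le_or_gt ‖v'‖ (1 / 3) with hr' | hr'
    · left
      apply key <;> rw [collapseScale_of_le hr]
      · rw [collapseScale_of_le hr']
      · norm_num
    · exfalso
      rw [collapseHeight_of_le hr] at h2
      rcases le_total ‖v'‖ (2 / 3) with h' | h'
      · rw [collapseHeight_of_mem hr'.le h'] at h2
        linarith
      · rw [collapseHeight_of_ge h'] at h2
        linarith
  rcases lt_or_ge ‖v‖ (2 / 3) with hr2 | hr2
  · rw [collapseHeight_of_mem hr.le hr2.le] at h2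
    have : ‖v'‖ = ‖v‖ := by
      rcases le_or_gt ‖v'‖ (1 / 3) with hr' | hr'
      · rw [collapseHeight_of_le hr'] at h2
        linarith
      rcases le_total ‖v'‖ (2 / 3) with h' | h'
      · rw [collapseHeight_of_mem hr'.le h'] at h2
        linarith
      · rw [collapseHeight_of_ge h'] at h2
        linarith
    left
    apply key
    · rw [this]
    · rw [collapseScale_of_mem hr.le hr2.le]
      exact inv_ne_zero (by linarith)
  · rw [collapseHeight_of_ge hr2] at h2
    have hr2' : 2 / 3 ≤ ‖v'‖ := by
      by_contra! h'
      rcases le_or_gt ‖v'‖ (1 / 3) with hr' | hr'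
      · rw [collapseHeight_of_le hr'] at h2
        linarith
      · rw [collapseHeight_of_mem hr'.le h'.le] at h2
        linarith
    rw [collapseScale_of_ge hr2, collapseScale_of_ge hr2', div_mul_cancel₀ _ (by linarith),
      div_mul_cancel₀ _ (by linarith)] at h3
    have : ‖v'‖ = ‖v‖ := by linarith
    rcases hv.eq_or_lt with h | h
    · exact .inr ⟨h, this.trans h⟩
    · left
      apply key
      · rw [this]
      · rw [collapseScale_of_ge hr2]
        exact div_ne_zero (by linarith) (by linarith)

theorem exists_collapse_eq [Nontrivial V] {p : V × ℝ} (hp : ‖p‖ = 1) :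
    ∃ v : V, ‖v‖ ≤ 1 ∧ collapse v = p := by
  obtain ⟨v, s⟩ := p
  rw [Prod.norm_mk, Real.norm_eq_abs] at hp
  have hv : ‖v‖ ≤ 1 := hp ▸ le_max_left _ _
  have hs : |s| ≤ 1 := hp ▸ le_max_right _ _
  have hv0 := norm_nonneg v
  obtain ⟨hs1, hs2⟩ := abs_le.1 hs
  rcases hs1.eq_or_lt with rfl | hs1
  · have h : ‖(1 / 3 : ℝ) • v‖ = ‖v‖ / 3 := by
      rw [norm_smul, Real.norm_of_nonneg (by norm_num)]
      ring
    have h' : ‖v‖ / 3 ≤ 1 / 3 := by linarith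
    refine ⟨(1 / 3 : ℝ) • v, by linarith, ?_⟩
    rw [collapse, h, collapseScale_of_le h', collapseHeight_of_le h', smul_smul]
    norm_num
  rcases hs2.eq_or_lt with rfl | hs2
  · by_cases h0 : v = 0
    · obtain ⟨w, hw⟩ := exists_norm_eq V zero_le_one
      exact ⟨w, hw.le, by rw [collapse_of_norm_eq_one hw, h0]⟩
    have hvp : 0 < ‖v‖ := norm_pos_iff.2 h0
    have h : ‖((1 - ‖v‖ / 3) / ‖v‖) • v‖ = 1 - ‖v‖ / 3 := by
      rw [norm_smul, Real.norm_of_nonneg (div_nonneg (by linarith) hv0),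
        div_mul_cancel₀ _ hvp.ne']
    have h' : 2 / 3 ≤ 1 - ‖v‖ / 3 := by linarith
    refine ⟨((1 - ‖v‖ / 3) / ‖v‖) • v, by linarith, ?_⟩
    rw [collapse, h, collapseScale_of_ge h', collapseHeight_of_ge h', smul_smul]
    have : 3 * (1 - (1 - ‖v‖ / 3)) / (1 - ‖v‖ / 3) * ((1 - ‖v‖ / 3) / ‖v‖) = 1 := by
      have : 3 - ‖v‖ ≠ 0 := by linarith
      field_simp
      ring
    rw [this, one_smul]
  · have hv1 : ‖v‖ = 1 := by
      rcases max_choice ‖v‖ |s| with h | h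
      · rw [← h, hp]
      · exact absurd (h.symm.trans hp) (abs_lt.2 ⟨hs1, hs2⟩).ne
    have h : ‖((s + 3) / 6) • v‖ = (s + 3) / 6 := by
      rw [norm_smul, hv1, mul_one, Real.norm_of_nonneg (by linarith)]
    have h1 : 1 / 3 ≤ (s + 3) / 6 := by linarith
    have h2 : (s + 3) / 6 ≤ 2 / 3 := by linarith
    refine ⟨((s + 3) / 6) • v, by linarith, ?_⟩
    rw [collapse, h, collapseScale_of_mem h1 h2, collapseHeight_of_mem h1 h2,
      inv_smul_smul₀ (by linarith)]
    congr 1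
    ring

/-- If each map from the closed unit ball of `V` to `E` that is constant on the boundary is
null-homotopic relative to the boundary, then each map from the unit sphere of `V × ℝ` to `E`
extends to the closed unit ball. -/
theorem exists_extension_of_sphere [Nontrivial V] [ProperSpace V]
    {E : Type*} [TopologicalSpace E]
    (hE : ∀ (e : E) (g : C(closedBall (0 : V) 1, E)), (∀ w, ‖w.1‖ = 1 → g w = e) →
      ∃ H : C(I × closedBall (0 : V) 1, E), (∀ w, H (0, w) = g w) ∧ (∀ w, H (1, w) = e) ∧
        ∀ t w, ‖w.1‖ = 1 → H (t, w) = e)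
    (f : C(sphere (0 : V × ℝ) 1, E)) :
    ∃ F : C(closedBall (0 : V × ℝ) 1, E), ∀ x : sphere (0 : V × ℝ) 1,
      F ⟨x, sphere_subset_closedBall x.2⟩ = f x := by
  have hc : ∀ w : closedBall (0 : V) 1, ‖collapse w.1‖ = 1 := fun w =>
    norm_collapse (mem_closedBall_zero_iff.1 w.2)
  let g : C(closedBall (0 : V) 1, E) :=
    f.comp ⟨fun w => ⟨collapse w.1, mem_sphere_zero_iff_norm.2 (hc w)⟩,
      (continuous_collapse.comp continuous_subtype_val).subtype_mk _⟩
  obtain ⟨H, H0, H1, Hb⟩ := hE (f ⟨(0, 1), by simp [Prod.norm_mk]⟩) g fun w hw =>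
    congrArg f (Subtype.ext (collapse_of_norm_eq_one hw))
  have hm : ∀ p : I × closedBall (0 : V) 1, ‖(1 - p.1 : ℝ) • collapse p.2.1‖ = 1 - p.1 := by
    intro p
    rw [norm_smul, hc, mul_one, Real.norm_of_nonneg (by linarith [p.1.2.2])]
  -- The ball is the cone on its boundary sphere, hence a quotient of `I × closedBall`. `H` descends
  -- because it is constant at time `1` and on the boundary of the ball.
  let m : I × closedBall (0 : V) 1 → closedBall (0 : V × ℝ) 1 := fun p =>
    ⟨(1 - p.1 : ℝ) • collapse p.2.1, by
      rw [mem_closedBall_zero_iff, hm]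
      linarith [p.1.2.1]⟩
  have hmc : Continuous m := by
    have h : Continuous fun p : I × closedBall (0 : V) 1 => collapse p.2.1 :=
      continuous_collapse.comp (by fun_prop)
    exact Continuous.subtype_mk (by fun_prop) _
  have hms : Function.Surjective m := by
    rintro ⟨x, hx⟩
    rw [mem_closedBall_zero_iff] at hx
    by_cases h0 : x = 0
    · exact ⟨(1, ⟨0, by simp⟩), Subtype.ext (by simp [m, h0])⟩
    · have hx0 : ‖x‖ ≠ 0 := norm_ne_zero_iff.2 h0
      obtain ⟨v, hv, h⟩ := exists_collapse_eq (p := ‖x‖⁻¹ • x) (by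
        rw [norm_smul, norm_inv, norm_norm, inv_mul_cancel₀ hx0])
      refine ⟨(⟨1 - ‖x‖, by linarith, by linarith [norm_nonneg x]⟩,
        ⟨v, mem_closedBall_zero_iff.2 hv⟩), Subtype.ext ?_⟩
      simp [m, h, smul_smul, hx0]
  have hmq : Topology.IsQuotientMap (⟨m, hmc⟩ : C(_, _)) := hmc.isClosedMap.isQuotientMap hmc hms
  have hfac : Function.FactorsThrough H (⟨m, hmc⟩ : C(_, _)) := by
    rintro ⟨t, w⟩ ⟨t', w'⟩ h
    have h' : (1 - t : ℝ) • collapse w.1 = (1 - t' : ℝ) • collapse w'.1 := congrArg Subtype.val h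
    obtain rfl : t = t' := by
      have := congrArg norm h'
      rw [hm (t, w), hm (t', w')] at this
      exact Subtype.ext (by simpa using this)
    by_cases ht : t = 1
    · rw [ht, H1, H1]
    · have ht' : (1 - t : ℝ) ≠ 0 := by
        rw [sub_ne_zero]
        exact fun h => ht (Subtype.ext h.symm)
      rcases collapse_inj (mem_closedBall_zero_iff.1 w.2) (mem_closedBall_zero_iff.1 w'.2)
        (smul_right_injective _ ht' h') with h | ⟨h1, h2⟩
      · rw [Subtype.ext h]
      · rw [Hb _ _ h1, Hb _ _ h2]
  refine ⟨hmq.lift H hfac, fun x => ?_⟩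
  obtain ⟨v, hv, h⟩ := exists_collapse_eq (mem_sphere_zero_iff_norm.1 x.2)
  have : (⟨x, sphere_subset_closedBall x.2⟩ : closedBall (0 : V × ℝ) 1) =
      m (0, ⟨v, mem_closedBall_zero_iff.2 hv⟩) := Subtype.ext (by simp [m, h])
  rw [this]
  refine (DFunLike.congr_fun (hmq.lift_comp H hfac) _).trans ?_
  rw [H0]
  exact congrArg f (Subtype.ext h)

end Collapse

/-! ### Filling homotopies in spaces with trivial homotopy groups. -/

section Filling

open scoped Topology

variable {E : Type*} [TopologicalSpace E]

theorem norm_eq_one_of_abs_eq_one {ι : Type*} [Fintype ι] (w : closedBall (0 : ι → ℝ) 1) {i : ι}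
    (h : |w.1 i| = 1) : ‖w.1‖ = 1 :=
  le_antisymm (mem_closedBall_zero_iff.1 w.2) (h.ge.trans (norm_le_pi_norm w.1 i))

theorem exists_abs_eq_one {ι : Type*} [Fintype ι] {w : ι → ℝ} (hw : ‖w‖ = 1) :
    ∃ i, |w i| = 1 := by
  by_contra! h
  refine hw.not_lt ((pi_norm_lt_iff zero_lt_one).2 fun i => ?_)
  exact lt_of_le_of_ne (hw ▸ norm_le_pi_norm w i) (h i)

/-- Maps from a closed cube to a space with trivial homotopy groups that are constant on the
boundary are null-homotopic relative to the boundary. -/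
theorem exists_nullhomotopy (hπ : ∀ n (e : E), Subsingleton (HomotopyGroup.Pi n E e))
    {ι : Type*} [Fintype ι] (e : E) (g : C(closedBall (0 : ι → ℝ) 1, E))
    (hg : ∀ w, ‖w.1‖ = 1 → g w = e) :
    ∃ H : C(I × closedBall (0 : ι → ℝ) 1, E), (∀ w, H (0, w) = g w) ∧ (∀ w, H (1, w) = e) ∧
      ∀ t w, ‖w.1‖ = 1 → H (t, w) = e := by
  classical
  let φ := Fintype.equivFin ι
  let n := Fintype.card ι
  -- `r` and `s` identify `[0, 1] ^ n` with `[-1, 1] ^ ι` affinely, boundary to boundary.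
  let r : C(Fin n → I, closedBall (0 : ι → ℝ) 1) :=
    ⟨fun x => ⟨fun i => 2 * (x (φ i) : ℝ) - 1, mem_closedBall_zero_iff.2 <|
      (pi_norm_le_iff_of_nonneg zero_le_one).2 fun i => abs_le.2
        ⟨by linarith [(x (φ i)).2.1], by linarith [(x (φ i)).2.2]⟩⟩,
      Continuous.subtype_mk (by fun_prop) _⟩
  let s : C(closedBall (0 : ι → ℝ) 1, Fin n → I) :=
    ⟨fun w j => projIcc 0 1 zero_le_one ((w.1 (φ.symm j) + 1) / 2),
      continuous_pi fun j => continuous_projIcc.comp <|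
        (((continuous_apply (φ.symm j)).comp continuous_subtype_val).add_const 1).div_const 2⟩
  have hw : ∀ (w : closedBall (0 : ι → ℝ) 1) i, -1 ≤ w.1 i ∧ w.1 i ≤ 1 := fun w i =>
    abs_le.1 ((norm_le_pi_norm w.1 i).trans (mem_closedBall_zero_iff.1 w.2))
  have hrs : ∀ w, r (s w) = w := by
    intro w
    refine Subtype.ext (funext fun i => ?_)
    change 2 * (projIcc (0 : ℝ) 1 zero_le_one ((w.1 (φ.symm (φ i)) + 1) / 2) : ℝ) - 1 = w.1 i
    have := hw w i
    rw [φ.symm_apply_apply, projIcc_of_mem zero_le_one ⟨by linarith, by linarith⟩]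
    ring
  let f : GenLoop (Fin n) E e := ⟨g.comp r, fun x ⟨j, hj⟩ => hg _ <|
    norm_eq_one_of_abs_eq_one (r x) (i := φ.symm j) <| by
      change |2 * (x (φ (φ.symm j)) : ℝ) - 1| = 1
      rw [φ.apply_symm_apply]
      rcases hj with h | h <;> norm_num [h]⟩
  have := hπ n e
  obtain ⟨H⟩ : GenLoop.Homotopic f GenLoop.const := Quotient.exact <|
    Subsingleton.elim (α := HomotopyGroup.Pi n E e) ⟦f⟧ ⟦GenLoop.const⟧
  refine ⟨H.toContinuousMap.comp ((ContinuousMap.id I).prodMap s), fun w => ?_, fun w => ?_,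
    fun t w hw' => ?_⟩
  · exact (H.apply_zero (s w)).trans (congrArg g (hrs w))
  · exact H.apply_one (s w)
  · obtain ⟨i, hi⟩ := exists_abs_eq_one hw'
    refine (H.prop t (s w) ⟨φ i, ?_⟩).trans ?_
    · change projIcc (0 : ℝ) 1 zero_le_one ((w.1 (φ.symm (φ i)) + 1) / 2) = 0 ∨
        projIcc (0 : ℝ) 1 zero_le_one ((w.1 (φ.symm (φ i)) + 1) / 2) = 1
      rw [φ.symm_apply_apply]
      rcases eq_or_eq_neg_of_abs_eq hi with h | h <;> rw [h]
      · right
        norm_num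
      · left
        norm_num
    · exact (congrArg g (hrs w)).trans (hg w hw')

/-- In a space with trivial homotopy groups, a homotopy between the restrictions of two maps to
the boundary of a cube extends to the cube. -/
theorem exists_filling [PathConnectedSpace E]
    (hπ : ∀ n (e : E), Subsingleton (HomotopyGroup.Pi n E e))
    {ι : Type*} [Fintype ι] (a b : C(closedBall (0 : ι → ℝ) 1, E))
    (H : C(I × {w : closedBall (0 : ι → ℝ) 1 // ‖w.1‖ = 1}, E))
    (h0 : ∀ w, H (0, w) = a w) (h1 : ∀ w, H (1, w) = b w) :
    ∃ T : C(I × closedBall (0 : ι → ℝ) 1, E),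
      (∀ w, T (0, w) = a w) ∧ (∀ w, T (1, w) = b w) ∧ ∀ t w, T (t, w.1) = H (t, w) := by
  rcases isEmpty_or_nonempty ι with hι | hι
  -- A zero-dimensional cube has empty boundary; a path between the two values is all that is
  -- needed.
  · let γ := PathConnectedSpace.somePath (a ⟨0, by simp⟩) (b ⟨0, by simp⟩)
    have hs : ∀ w : closedBall (0 : ι → ℝ) 1, w = ⟨0, by simp⟩ := fun w =>
      Subtype.ext (Subsingleton.elim _ _)
    refine ⟨γ.toContinuousMap.comp ContinuousMap.fst, fun w => ?_, fun w => ?_, fun t w => ?_⟩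
    · exact γ.source.trans (congrArg a (hs w).symm)
    · exact γ.target.trans (congrArg b (hs w).symm)
    · have := w.2
      rw [Subsingleton.elim w.1.1 0, norm_zero] at this
      exact absurd this zero_ne_one
  let V := ι → ℝ
  let ret := unitRetraction V
  let τ : C(sphere (0 : V × ℝ) 1, I) :=
    ⟨fun x => projIcc 0 1 zero_le_one ((x.1.2 + 1) / 2), continuous_projIcc.comp (by fun_prop)⟩
  let H' : {x : sphere (0 : V × ℝ) 1 // ‖x.1.1‖ = 1} → E := fun x =>
    H (τ x.1, ⟨ret x.1.1.1, norm_unitRetraction x.2.ge⟩)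
  have hH'c : Continuous H' := by
    refine H.continuous.comp (Continuous.prodMk (by fun_prop) (Continuous.subtype_mk ?_ _))
    exact ret.continuous.comp (by fun_prop)
  classical
  -- On the surface of the cylinder use `a` on the bottom, `b` on the top and `H` on the wall.
  -- Extending over the solid cylinder gives the filling, with time `t` at height `2 * t - 1`.
  let f : sphere (0 : V × ℝ) 1 → E := fun x =>
    if h : ‖x.1.1‖ = 1 then H' ⟨x, h⟩ else
      if x.1.2 ≤ 0 then a (ret x.1.1) else b (ret x.1.1)
  have hf0 : ∀ x, x.1.2 = -1 → f x = a (ret x.1.1) := by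
    intro x hx
    by_cases h : ‖x.1.1‖ = 1
    · have hτ : τ x = 0 := by
        change projIcc (0 : ℝ) 1 zero_le_one _ = 0
        rw [hx]
        norm_num
      rw [show f x = _ from dif_pos h]
      change H (τ x, _) = _
      rw [hτ, h0]
    · rw [show f x = _ from dif_neg h, if_pos (by rw [hx]; norm_num)]
  have hf1 : ∀ x, x.1.2 = 1 → f x = b (ret x.1.1) := by
    intro x hx
    by_cases h : ‖x.1.1‖ = 1
    · have hτ : τ x = 1 := by
        change projIcc (0 : ℝ) 1 zero_le_one _ = 1
        rw [hx]
        norm_num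
      rw [show f x = _ from dif_pos h]
      change H (τ x, _) = _
      rw [hτ, h1]
    · rw [show f x = _ from dif_neg h, if_neg (by rw [hx]; norm_num)]
  have hfc : Continuous f := by
    have hA : ContinuousOn f {x | x.1.2 = -1} :=
      ((a.comp ret).continuous.comp (continuous_fst.comp continuous_subtype_val)).continuousOn.congr
        hf0
    have hB : ContinuousOn f {x | x.1.2 = 1} :=
      ((b.comp ret).continuous.comp (continuous_fst.comp continuous_subtype_val)).continuousOn.congr
        hf1
    have hC : ContinuousOn f {x | ‖x.1.1‖ = 1} := by
      rw [continuousOn_iff_continuous_domRestrict]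
      exact hH'c.congr fun x => (show f x.1 = H' x from dif_pos x.2).symm
    have hA' : IsClosed {x : sphere (0 : V × ℝ) 1 | x.1.2 = -1} :=
      isClosed_eq (by fun_prop) continuous_const
    have hB' : IsClosed {x : sphere (0 : V × ℝ) 1 | x.1.2 = 1} :=
      isClosed_eq (by fun_prop) continuous_const
    have hC' : IsClosed {x : sphere (0 : V × ℝ) 1 | ‖x.1.1‖ = 1} :=
      isClosed_eq (by fun_prop) continuous_const
    rw [← continuousOn_univ]
    refine ((hA.union_of_isClosed hB hA' hB').union_of_isClosed hC (hA'.union hB') hC').mono ?_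
    intro x _
    have hx := mem_sphere_zero_iff_norm.1 x.2
    rw [Prod.norm_def, Real.norm_eq_abs] at hx
    rcases max_choice ‖x.1.1‖ |x.1.2| with h | h
    · exact .inr (h.symm.trans hx)
    · rcases eq_or_eq_neg_of_abs_eq (h.symm.trans hx) with h | h
      exacts [.inl (.inr h), .inl (.inl h)]
  obtain ⟨F, hF⟩ := exists_extension_of_sphere (V := V) (fun e g => exists_nullhomotopy hπ e g)
    ⟨f, hfc⟩
  have hm : ∀ p : I × closedBall (0 : V) 1, ‖(p.2.1, (2 * p.1 - 1 : ℝ))‖ ≤ 1 := fun p =>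
    norm_prod_le_iff.2 ⟨mem_closedBall_zero_iff.1 p.2.2, abs_le.2
      ⟨by linarith [p.1.2.1], by linarith [p.1.2.2]⟩⟩
  let m : C(I × closedBall (0 : V) 1, closedBall (0 : V × ℝ) 1) :=
    ⟨fun p => ⟨(p.2.1, 2 * p.1 - 1), mem_closedBall_zero_iff.2 (hm p)⟩,
      Continuous.subtype_mk (by fun_prop) _⟩
  have hFm : ∀ (p : I × closedBall (0 : V) 1) (h : ‖(p.2.1, (2 * p.1 - 1 : ℝ))‖ = 1),
      F (m p) = f ⟨(p.2.1, 2 * p.1 - 1), mem_sphere_zero_iff_norm.2 h⟩ := fun p h => hF ⟨_, _⟩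
  refine ⟨F.comp m, fun w => ?_, fun w => ?_, fun t w => ?_⟩
  · have hw : ‖w.1‖ ≤ 1 := mem_closedBall_zero_iff.1 w.2
    change F (m (0, w)) = _
    rw [hFm (0, w) (by simp [Prod.norm_def, hw]), hf0 _ (by simp)]
    exact congrArg a (unitRetraction_coe w)
  · have hw : ‖w.1‖ ≤ 1 := mem_closedBall_zero_iff.1 w.2
    change F (m (1, w)) = _
    rw [hFm (1, w) (by norm_num [Prod.norm_def, hw]), hf1 _ (by norm_num)]
    exact congrArg b (unitRetraction_coe w)
  · change F (m (t, w.1)) = _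
    have h : ‖(w.1.1, (2 * t - 1 : ℝ))‖ = 1 :=
      le_antisymm (hm (t, w.1)) (w.2.ge.trans (norm_fst_le (w.1.1, (2 * t - 1 : ℝ))))
    rw [hFm (t, w.1) h, show f _ = _ from dif_pos w.2]
    refine congrArg H (Prod.ext ?_ (Subtype.ext (unitRetraction_coe w.1)))
    change projIcc (0 : ℝ) 1 zero_le_one ((2 * t - 1 + 1) / 2) = t
    rw [show ((2 * t - 1 + 1) / 2 : ℝ) = t by ring, projIcc_val]

/-- In degrees `0` and `1` this is simple connectedness; in higher degrees null-homotopies relative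
to the boundary lift from `X`. -/
theorem IsUniversalCovering.subsingleton_pi {X : Type u} {E : Type v} [TopologicalSpace X]
    [TopologicalSpace E] {P : E → X} (hP : IsUniversalCovering P)
    (hX : ∀ n, 2 ≤ n → ∀ x : X, Subsingleton (HomotopyGroup.Pi n X x)) (n : ℕ) (e : E) :
    Subsingleton (HomotopyGroup.Pi n E e) := by
  have := hP.simplyConnected
  match n with
  | 0 =>
    have : Subsingleton (ZerothHomotopy E) :=
      (pathConnectedSpace_iff_zerothHomotopy.1 inferInstance).2
    exact HomotopyGroup.pi0EquivZerothHomotopy.subsingleton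
  | 1 =>
    have : Subsingleton (FundamentalGroup E e) := inferInstance
    exact HomotopyGroup.pi1EquivFundamentalGroup.subsingleton
  | n + 2 =>
    have := hX (n + 2) (by lia) (P e)
    let π : C(E, X) := ⟨P, hP.isCoveringMap.continuous⟩
    refine ⟨fun f' g' => Quotient.inductionOn₂ f' g' fun f g => Quotient.sound ?_⟩
    have hb : (fun _ => 0 : Fin (n + 2) → I) ∈ Cube.boundary (Fin (n + 2)) := ⟨0, .inl rfl⟩
    refine (hP.isCoveringMap.homotopicRel_iff_comp
      ⟨_, hb, (f.2 _ hb).trans (g.2 _ hb).symm⟩).2 ?_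
    let f₁ : GenLoop (Fin (n + 2)) X (P e) := ⟨π.comp f.1, fun x hx => congrArg P (f.2 x hx)⟩
    let g₁ : GenLoop (Fin (n + 2)) X (P e) := ⟨π.comp g.1, fun x hx => congrArg P (g.2 x hx)⟩
    exact Quotient.exact <|
      Subsingleton.elim (α := HomotopyGroup.Pi (n + 2) X (P e)) ⟦f₁⟧ ⟦g₁⟧

end Filling

/-! ### A section that is continuous over finite unions of product cells. -/

namespace UniversalCovering

open scoped Topology

variable {X : Type u} {E : Type v} [TopologicalSpace E] {P : E → X}

theorem BalancedProduct.mk_smul (g : deckGroup P) (x y : E) :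
    BalancedProduct.mk P (g • x) (g • y) = BalancedProduct.mk P x y :=
  Quotient.sound ⟨g, rfl⟩

theorem BalancedProduct.exists_mk_eq (z : BalancedProduct P) :
    ∃ x y, BalancedProduct.mk P x y = z := by
  induction z using Quotient.inductionOn with
  | h p => exact ⟨p.1, p.2, rfl⟩

theorem BalancedProduct.exists_smul_of_mk_eq {x y x' y' : E}
    (h : BalancedProduct.mk P x y = BalancedProduct.mk P x' y') :
    ∃ g : deckGroup P, g • x' = x ∧ g • y' = y := by
  obtain ⟨g, hg⟩ := Quotient.exact h
  exact ⟨g, congrArg Prod.fst hg, congrArg Prod.snd hg⟩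

instance : ContinuousConstSMul (deckGroup P) E :=
  ⟨fun g => g.1.continuous⟩

theorem BalancedProduct.continuous_mk :
    Continuous fun p : E × E => BalancedProduct.mk P p.1 p.2 :=
  continuous_quotient_mk'

theorem BalancedProduct.isOpenMap_mk :
    IsOpenMap fun p : E × E => BalancedProduct.mk P p.1 p.2 :=
  isOpenMap_quotient_mk'_mul

variable [TopologicalSpace X]

theorem continuous_balancedProj (hP : Continuous P) : Continuous (balancedProj P) :=
  Continuous.quotient_lift (by fun_prop) _

theorem deckGroup_ext (hP : IsUniversalCovering P) {g g' : deckGroup P} {e : E}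
    (h : g • e = g' • e) : g = g' := by
  have := hP.simplyConnected
  refine Subtype.ext (Homeomorph.ext fun x => ?_)
  refine congrFun (hP.isCoveringMap.eq_of_comp_eq g.1.continuous g'.1.continuous ?_ e h) x
  exact funext fun x => (g.2 x).trans (g'.2 x).symm

/-- Radial contraction turns the map into the end of a homotopy from a constant map, which lifts. -/
theorem exists_lift_closedBall (hP : IsUniversalCovering P) {V : Type*} [NormedAddCommGroup V]
    [NormedSpace ℝ V] (φ : C(closedBall (0 : V) 1, X)) :
    ∃ L : C(closedBall (0 : V) 1, E), ∀ w, P (L w) = φ w := by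
  obtain ⟨e, he⟩ := hP.surjective (φ ⟨0, by simp⟩)
  have hs : ∀ p : I × closedBall (0 : V) 1, (p.1 : ℝ) • p.2.1 ∈ closedBall (0 : V) 1 := by
    intro p
    rw [mem_closedBall_zero_iff, norm_smul, Real.norm_of_nonneg p.1.2.1]
    exact mul_le_one₀ p.1.2.2 (norm_nonneg _) (mem_closedBall_zero_iff.1 p.2.2)
  let H : C(I × closedBall (0 : V) 1, X) :=
    φ.comp ⟨fun p => ⟨(p.1 : ℝ) • p.2.1, hs p⟩, Continuous.subtype_mk (by fun_prop) _⟩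
  have H0 : ∀ w, H (0, w) = P (ContinuousMap.const (closedBall (0 : V) 1) e w) := fun w =>
    (congrArg φ (Subtype.ext (zero_smul ℝ w.1))).trans he.symm
  refine ⟨(hP.isCoveringMap.liftHomotopy H _ H0).comp
    ((ContinuousMap.const _ 1).prodMk (ContinuousMap.id _)), fun w => ?_⟩
  refine (congrFun (hP.isCoveringMap.liftHomotopy_lifts H _ H0) (1, w)).trans ?_
  exact congrArg φ (Subtype.ext (one_smul ℝ w.1))

theorem exists_lift_of_pathProj_eq (hP : IsUniversalCovering P) {γ : C(I, X)} {x y : E}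
    (h : pathProj hP γ = BalancedProduct.mk P x y) :
    ∃ Γ : C(I, E), P ∘ Γ = γ ∧ Γ 0 = x ∧ Γ 1 = y := by
  obtain ⟨g, hx, hy⟩ := BalancedProduct.exists_smul_of_mk_eq h.symm
  refine ⟨(g.1 : C(E, E)).comp (exists_lift hP γ).choose, ?_, hx, hy⟩
  exact (funext fun t => g.2 _).trans (exists_lift hP γ).choose_spec

/-- A family of paths in the base over the boundary of a cube, with lifts having prescribed
endpoints, can be extended to the cube. -/
theorem exists_paths_extension (hP : IsUniversalCovering P)
    (hπ : ∀ n (e : E), Subsingleton (HomotopyGroup.Pi n E e)) {ι : Type*} [Fintype ι]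
    (a b : C(closedBall (0 : ι → ℝ) 1, E)) (φ : closedBall (0 : ι → ℝ) 1 → C(I, X))
    (hφ : ContinuousOn φ {w | ‖w.1‖ = 1})
    (hab : ∀ w, ‖w.1‖ = 1 → ∃ Γ : C(I, E), P ∘ Γ = φ w ∧ Γ 0 = a w ∧ Γ 1 = b w) :
    ∃ T : C(closedBall (0 : ι → ℝ) 1, C(I, X)), (∀ w, ‖w.1‖ = 1 → T w = φ w) ∧
      ∀ w, ∃ Γ : C(I, E), P ∘ Γ = T w ∧ Γ 0 = a w ∧ Γ 1 = b w := by
  have := hP.simplyConnected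
  let S := {w : closedBall (0 : ι → ℝ) 1 // ‖w.1‖ = 1}
  have hφ' : Continuous fun w : S => φ w.1 := continuousOn_iff_continuous_domRestrict.1 hφ
  let H : C(I × S, X) := ⟨fun p => φ p.2.1 p.1,
    continuous_eval.comp ((hφ'.comp continuous_snd).prodMk continuous_fst)⟩
  let a' : C(S, E) := a.comp ⟨Subtype.val, continuous_subtype_val⟩
  have H0 : ∀ w, H (0, w) = P (a' w) := by
    intro w
    obtain ⟨Γ, h, h0, -⟩ := hab w.1 w.2
    exact (congrFun h 0).symm.trans (congrArg P h0)
  let H' := hP.isCoveringMap.liftHomotopy H a' H0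
  -- The lifted family starts at `a`; by unique path lifting it also ends at `b`, so it can be
  -- filled in `E` and projected back.
  have H'1 : ∀ w, H' (1, w) = b w.1 := by
    intro w
    obtain ⟨Γ, h, h0, h1⟩ := hab w.1 w.2
    rw [← h1]
    refine congrFun (hP.isCoveringMap.eq_of_comp_eq (g₁ := fun t => H' (t, w)) (g₂ := Γ)
      (by fun_prop) Γ.continuous ?_ 0 ?_) 1
    · rw [h]
      exact funext fun t => congrFun (hP.isCoveringMap.liftHomotopy_lifts H a' H0) (t, w)
    · rw [h0]
      exact hP.isCoveringMap.liftHomotopy_zero H a' H0 w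
  obtain ⟨T, T0, T1, TS⟩ := exists_filling hπ a b H'
    (hP.isCoveringMap.liftHomotopy_zero H a' H0) H'1
  refine ⟨ContinuousMap.curry ⟨fun p => P (T (p.2, p.1)),
    hP.isCoveringMap.continuous.comp (by fun_prop)⟩, fun w hw => ?_, fun w => ?_⟩
  · ext t
    change P (T (t, w)) = φ w t
    rw [TS t ⟨w, hw⟩]
    exact congrFun (hP.isCoveringMap.liftHomotopy_lifts H a' H0) (t, ⟨w, hw⟩)
  · exact ⟨⟨fun t => T (t, w), by fun_prop⟩, rfl, T0 w, T1 w⟩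

variable [LocallyPathConnectedSpace X]

/-- A discontinuous section of `pathProj`, which is however continuous over products of finite
unions of closed cells. -/
theorem exists_section_over_cells [T2Space X] (hP : IsUniversalCovering P)
    (hπ : ∀ n (e : E), Subsingleton (HomotopyGroup.Pi n E e)) (K : CellSystem X) :
    ∃ f : BalancedProduct P → C(I, X), (∀ z, pathProj hP (f z) = z) ∧
      ∀ F F' : Finset K.Cell, ContinuousOn f
        (balancedProj P ⁻¹' (K.closedCells F ×ˢ K.closedCells F')) := by
  have := hP.simplyConnected
  have hPc := hP.isCoveringMap.continuous
  have hq := continuous_balancedProj hPc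
  choose L hL using fun c => exists_lift_closedBall hP (K.char c)
  have : Nonempty C(I, X) := ⟨.const I (P (Classical.arbitrary E))⟩
  obtain ⟨f, hf⟩ := (K.prod K).exists_extension (balancedProj P) (V := C(I, X))
    (fun c G => Continuous G ∧ ∀ p, pathProj hP (G p) = p.1.2) <| by
    intro c f hf
    -- Pulled back to a product cell, the covering `balancedProj` becomes trivial: its sheets `w ↦
    -- [a w, b g w]` are indexed by the deck transformations `g`, so paths can be extended on each
    -- sheet separately.
    let a : C((K.prod K).Cube c, E) := (L c.1).comp (cubeComp Sum.inl)
    let b : deckGroup P → C((K.prod K).Cube c, E) := fun g =>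
      ((g.1 : C(E, E)).comp (L c.2)).comp (cubeComp Sum.inr)
    have ha : ∀ w, P (a w) = ((K.prod K).char c w).1 := fun w => hL _ _
    have hb : ∀ g w, P (b g w) = ((K.prod K).char c w).2 := fun g w => (g.2 _).trans (hL _ _)
    have hab : ∀ g w, balancedProj P (BalancedProduct.mk P (a w) (b g w)) =
      (K.prod K).char c w := fun g w => Prod.ext (ha w) (hb g w)
    have hT : ∀ g, ∃ T : C((K.prod K).Cube c, C(I, X)),
        (∀ w, ‖w.1‖ = 1 → T w = f (BalancedProduct.mk P (a w) (b g w))) ∧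
        ∀ w, ∃ Γ : C(I, E), P ∘ Γ = T w ∧ Γ 0 = a w ∧ Γ 1 = b g w := by
      intro g
      refine exists_paths_extension hP hπ a (b g) (fun w => f (BalancedProduct.mk P (a w) (b g w)))
        ?_ fun w hw => exists_lift_of_pathProj_eq hP ?_
      · refine ((K.prod K).continuousOn_boundary (c := c) hq fun c' hc' => (hf c' hc').1).comp
          (BalancedProduct.continuous_mk.comp (a.continuous.prodMk (b g).continuous)).continuousOn
          fun w hw => ?_
        exact ⟨w, hw, (hab g w).symm⟩
      · obtain ⟨F, hF, hF'⟩ := (K.prod K).boundary c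
        obtain ⟨c', hc', w', hw'⟩ := hF' w hw
        exact (hf c' (hF c' hc')).2 ⟨(w', _), hw'.trans (hab g w).symm⟩
    choose T hT hTΓ using hT
    have hsheet : ∀ p : (K.prod K).Pull (balancedProj P) c,
        ∃ g, p.1.2 = BalancedProduct.mk P (a p.1.1) (b g p.1.1) := by
      rintro ⟨⟨w, z⟩, h⟩
      obtain ⟨x, y, rfl⟩ := z.exists_mk_eq
      obtain ⟨k, hk⟩ := exists_deck hP (a := x) (b := a w)
        ((congrArg Prod.fst h).symm.trans (ha w).symm)
      obtain ⟨g, hg⟩ := exists_deck hP (a := L c.2 (cubeComp Sum.inr w)) (b := k • y)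
        ((hL _ _).trans ((congrArg Prod.snd h).trans (proj_smul P k y).symm))
      refine ⟨g, ?_⟩
      change _ = BalancedProduct.mk P (a w) (g • L c.2 (cubeComp Sum.inr w))
      rw [hg, ← hk, BalancedProduct.mk_smul]
    have hsheet_unique : ∀ w g g', BalancedProduct.mk P (a w) (b g w) =
        BalancedProduct.mk P (a w) (b g' w) → g = g' := by
      intro w g g' h
      obtain ⟨k, hk, hk'⟩ := BalancedProduct.exists_smul_of_mk_eq h
      obtain rfl : k = 1 := deckGroup_ext hP (hk.trans (one_smul _ _).symm)
      rw [one_smul] at hk'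
      exact deckGroup_ext hP hk'.symm
    choose sheet hsheet using hsheet
    -- The sheet index is locally constant: nearby classes have representatives in open sets on
    -- which `P` is injective, and these must be the points of the same sheet.
    have hloc : ∀ p, ∀ᶠ p' in 𝓝 p, sheet p' = sheet p := by
      intro p
      obtain ⟨φ, hφ, hφP⟩ := hP.isCoveringMap.isLocalHomeomorph (a p.1.1)
      obtain ⟨ψ, hψ, hψP⟩ := hP.isCoveringMap.isLocalHomeomorph (b (sheet p) p.1.1)
      have h1 : ∀ᶠ p' in 𝓝 p, a p'.1.1 ∈ φ.source :=
        (a.continuous.comp (by fun_prop)).continuousAt.eventually_mem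
          (φ.open_source.mem_nhds hφ)
      have h2 : ∀ᶠ p' in 𝓝 p, b (sheet p) p'.1.1 ∈ ψ.source :=
        ((b (sheet p)).continuous.comp (by fun_prop)).continuousAt.eventually_mem
          (ψ.open_source.mem_nhds hψ)
      have h3 : ∀ᶠ p' in 𝓝 p, p'.1.2 ∈
          (fun q : E × E => BalancedProduct.mk P q.1 q.2) '' (φ.source ×ˢ ψ.source) := by
        refine ContinuousAt.eventually_mem (by fun_prop)
          ((BalancedProduct.isOpenMap_mk _ (φ.open_source.prod ψ.open_source)).mem_nhds ?_)
        exact ⟨(_, _), ⟨hφ, hψ⟩, (hsheet p).symm⟩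
      filter_upwards [h1, h2, h3] with p' h1 h2 h3
      obtain ⟨⟨x, y⟩, ⟨hx, hy⟩, h⟩ := h3
      have h' : (P x, P y) = (K.prod K).char c p'.1.1 := by
        rw [p'.2, ← h]
        rfl
      have ex : x = a p'.1.1 := by
        refine φ.injOn hx h1 ?_
        rw [← hφP, ha, ← h']
      have ey : y = b (sheet p) p'.1.1 := by
        refine ψ.injOn hy h2 ?_
        rw [← hψP, hb, ← h']
      refine hsheet_unique p'.1.1 _ _ ?_
      rw [← hsheet, ← h, ex, ey]
    refine ⟨fun p => T (sheet p) p.1.1, fun p hp => ?_, ?_, fun p => ?_⟩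
    · exact (hT _ _ hp).trans (congrArg f (hsheet p).symm)
    · refine continuous_iff_continuousAt.2 fun p => ?_
      have h : Continuous fun p' : (K.prod K).Pull (balancedProj P) c => T (sheet p) p'.1.1 :=
        (T (sheet p)).continuous.comp (by fun_prop)
      refine h.continuousAt.congr ?_
      filter_upwards [hloc p] with p' hp'
      rw [hp']
    · obtain ⟨Γ, h, h0, h1⟩ := hTΓ (sheet p) p.1.1
      rw [pathProj_eq hP _ Γ h, h0, h1, ← hsheet]
  refine ⟨f, fun z => ?_, fun F F' => ?_⟩
  · obtain ⟨c, p, -, rfl⟩ := (K.prod K).exists_pull (balancedProj P) z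
    exact (hf c).2 p
  · refine ((K.prod K).continuousOn_finite hq (F ×ˢ F') fun c _ => (hf c).1).mono ?_
    rintro z ⟨h, h'⟩
    obtain ⟨c, hc, h⟩ := mem_iUnion₂.1 h
    obtain ⟨c', hc', h'⟩ := mem_iUnion₂.1 h'
    exact mem_iUnion₂.2 ⟨(c, c'), Finset.mk_mem_product hc hc', K.mem_range_prod_char h h'⟩

end UniversalCovering

/-! ### The continuous global section. -/

namespace UniversalCovering

open scoped Topology

variable {X : Type u} {E : Type v} [TopologicalSpace E] {P : E → X}
variable [TopologicalSpace X] [LocallyPathConnectedSpace X]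

theorem exists_section_of_subsingleton_pi [T2Space X] (hP : IsUniversalCovering P)
    (hπ : ∀ n (e : E), Subsingleton (HomotopyGroup.Pi n E e)) {K : CellSystem X} (hK : K.IsWeak) :
    ∃ s : C(BalancedProduct P, C(I, X)), ∀ z, pathProj hP (s z) = z := by
  have := hP.simplyConnected
  have hPc := hP.isCoveringMap.continuous
  have : Nonempty X := ⟨P (Classical.arbitrary E)⟩
  obtain ⟨f, hf, hfc⟩ := exists_section_over_cells hP hπ K
  obtain ⟨h, h0, h1⟩ := hK.exists_deformation
  let H : C(I × E, X) := ⟨fun p => h (P p.2) p.1, by fun_prop⟩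
  have H0 : ∀ e, H (0, e) = P (ContinuousMap.id E e) := fun e => h0 _
  let k : C(I × E, E) := hP.isCoveringMap.liftHomotopy H _ H0
  have hk : ∀ t e, P (k (t, e)) = h (P e) t := fun t e =>
    congrFun (hP.isCoveringMap.liftHomotopy_lifts H _ H0) (t, e)
  have hk0 : ∀ e, k (0, e) = e := fun e => hP.isCoveringMap.liftHomotopy_zero H _ H0 e
  -- Both sides lift the same path and agree at time `0`.
  have hkg : ∀ (g : deckGroup P) t e, k (t, g • e) = g • k (t, e) := by
    intro g t e
    refine congrFun (hP.isCoveringMap.eq_of_comp_eq (g₁ := fun t => k (t, g • e))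
      (g₂ := fun t => g • k (t, e)) (by fun_prop)
      (g.1.continuous.comp (k.continuous.comp (Continuous.prodMk_left e))) ?_ 0 ?_) t
    · funext t
      simp only [Function.comp_apply, proj_smul, hk]
    · rw [hk0, hk0]
  let κ : ∀ e, Path e (k (1, e)) := fun e =>
    { toFun := fun t => k (t, e)
      continuous_toFun := by fun_prop
      source' := hk0 e
      target' := rfl }
  let z₁ : E × E → BalancedProduct P := fun p => BalancedProduct.mk P (k (1, p.1)) (k (1, p.2))
  have hz₁ : Continuous z₁ := BalancedProduct.continuous_mk.comp
    (f := fun p : E × E => (k (1, p.1), k (1, p.2))) (by fun_prop)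
  have hfz : Continuous fun p => f (z₁ p) := by
    -- Near `p`, the map `z₁` lands over a product of two finite unions of closed cells, where `f`
    -- is continuous.
    refine continuous_iff_continuousAt.2 fun p => ?_
    obtain ⟨U, hU, hpU, F, hF⟩ := h1 (P p.1)
    obtain ⟨U', hU', hpU', F', hF'⟩ := h1 (P p.2)
    have hmaps : MapsTo z₁ ((fun p : E × E => (P p.1, P p.2)) ⁻¹' (U ×ˢ U'))
        (balancedProj P ⁻¹' (K.closedCells F ×ˢ K.closedCells F')) := by
      intro p' hp'
      refine ⟨?_, ?_⟩
      · change P (k (1, p'.1)) ∈ _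
        rw [hk]
        exact hF _ hp'.1
      · change P (k (1, p'.2)) ∈ _
        rw [hk]
        exact hF' _ hp'.2
    refine ((hfc F F').comp hz₁.continuousOn hmaps).continuousAt ?_
    exact ((hU.prod hU').preimage (by fun_prop)).mem_nhds ⟨hpU, hpU'⟩
  have hend : ∀ z, (f z 0, f z 1) = balancedProj P z := fun z => by
    rw [← balancedProj_pathProj hP, hf]
  let γ : ∀ p : E × E, Path (P (k (1, p.1))) (P (k (1, p.2))) := fun p =>
    { toContinuousMap := f (z₁ p)
      source' := congrArg Prod.fst (hend (z₁ p))
      target' := congrArg Prod.snd (hend (z₁ p)) }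
  let ω : ∀ p : E × E, Path (P p.1) (P p.2) := fun p =>
    (((κ p.1).map hPc).trans (γ p)).trans ((κ p.2).symm.map hPc)
  have hω : Continuous fun p : (E × E) × I => ω p.1 p.2 := by
    have c1 : Continuous fun p : (E × E) × I => ((κ p.1.1).map hPc) p.2 := by
      change Continuous fun p : (E × E) × I => P (k (p.2, p.1.1))
      fun_prop
    have c2 : Continuous fun p : (E × E) × I => γ p.1 p.2 :=
      continuous_eval.comp ((hfz.comp continuous_fst).prodMk continuous_snd)
    have c3 : Continuous fun p : (E × E) × I => ((κ p.1.2).symm.map hPc) p.2 := by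
      change Continuous fun p : (E × E) × I => P (k (unitInterval.symm p.2, p.1.2))
      fun_prop
    exact Path.trans_continuous_family (fun p : E × E => ((κ p.1).map hPc).trans (γ p))
      (Path.trans_continuous_family (fun p : E × E => (κ p.1).map hPc) c1 γ c2)
      (fun p : E × E => (κ p.2).symm.map hPc) c3
  let s : C(E × E, C(I, X)) := ContinuousMap.curry ⟨_, hω⟩
  have hs : ∀ (g : deckGroup P) p, s (g • p) = s p := by
    intro g p
    have e1 : ∀ t, ((κ (g • p.1)).map hPc) t = ((κ p.1).map hPc) t := fun t => by
      change P (k (t, g • p.1)) = P (k (t, p.1))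
      rw [hk, hk, proj_smul P]
    have e2 : ∀ t, (γ (g • p)) t = γ p t := fun t => by
      change f (BalancedProduct.mk P (k (1, g • p.1)) (k (1, g • p.2))) t = _
      rw [hkg, hkg, BalancedProduct.mk_smul]
      rfl
    have e3 : ∀ t, ((κ (g • p.2)).symm.map hPc) t = ((κ p.2).symm.map hPc) t := fun t => by
      change P (k (_, g • p.2)) = P (k (_, p.2))
      rw [hk, hk, proj_smul P]
    ext t
    change ω (g • p) t = ω p t
    simp only [ω, Path.trans_apply]
    split_ifs
    · exact e1 _
    · exact e2 _
    · exact e3 _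
  refine ⟨⟨Quotient.lift s ?_, s.continuous.quotient_lift _⟩, fun z => ?_⟩
  · rintro a b ⟨g, rfl⟩
    exact hs g b
  · obtain ⟨x, y, rfl⟩ := z.exists_mk_eq
    obtain ⟨Γ, hΓ, hΓ0, hΓ1⟩ := exists_lift_of_pathProj_eq hP (hf (z₁ (x, y)))
    let Γ' : Path (k (1, x)) (k (1, y)) :=
      { toContinuousMap := Γ
        source' := hΓ0
        target' := hΓ1 }
    have hΓ' : γ (x, y) = Γ'.map hPc := Path.ext hΓ.symm
    -- This path from `x` to `y` in `E` lifts `ω (x, y)`, so its endpoints compute `pathProj`.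
    let Δ : Path x y := ((κ x).trans Γ').trans (κ y).symm
    have hΔ : ω (x, y) = Δ.map hPc := by
      simp only [ω, Δ, Path.map_trans, hΓ']
    change pathProj hP (s (x, y)) = _
    rw [pathProj_eq hP (s (x, y)) Δ.toContinuousMap]
    · exact congrArg₂ _ Δ.source Δ.target
    · exact (congrArg (fun δ : Path (P x) (P y) => (δ : I → X)) hΔ).symm

end UniversalCovering

/-! ### Free and based null-homotopies of generalized loops. -/

section StretchedCube

/-- The linear expansion of the unit interval about its center, cut off at the ends. -/
noncomputable def expand : C(I × I, I) :=
  ⟨fun p => projIcc 0 1 zero_le_one (p.2 + p.1 * (p.2 - 1 / 2)),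
    continuous_projIcc.comp (by fun_prop)⟩

theorem expand_zero (u : I) : expand (0, u) = u := by
  simp [expand]

theorem expand_of_eq {u : I} (t : I) (hu : u = 0 ∨ u = 1) : expand (t, u) = u := by
  have ht := t.2.1
  rcases hu with rfl | rfl
  · refine projIcc_of_le_left zero_le_one ?_
    change (0 : ℝ) + t * (0 - 1 / 2) ≤ 0
    linarith
  · refine projIcc_of_right_le zero_le_one ?_
    change (1 : ℝ) ≤ 1 + t * (1 - 1 / 2)
    linarith

/-- A function on the unit interval that vanishes at the ends and is constant `1` on the middle
part, which is expanded to the whole interval by `expand`. -/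
noncomputable def plateau : C(I, I) :=
  ⟨fun u => projIcc 0 1 zero_le_one (min (4 * u) (4 * (1 - u))),
    continuous_projIcc.comp (by fun_prop)⟩

theorem plateau_of_eq {u : I} (hu : u = 0 ∨ u = 1) : plateau u = 0 := by
  refine projIcc_of_le_left zero_le_one ?_
  rcases hu with rfl | rfl <;> simp

/-- At time `1` the expansion is `2 * u - 1 / 2`, cut off; it stays off the ends only for `1 / 4 < u
< 3 / 4`, where both `4 * u` and `4 * (1 - u)` exceed `1`. -/
theorem plateau_eq_one {u : I} (h0 : expand (1, u) ≠ 0) (h1 : expand (1, u) ≠ 1) :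
    plateau u = 1 := by
  refine projIcc_of_right_le zero_le_one ?_
  have h0' : (1 / 4 : ℝ) < u := by
    by_contra! h
    refine h0 (projIcc_of_le_left zero_le_one ?_)
    change (u : ℝ) + 1 * (u - 1 / 2) ≤ 0
    linarith
  have h1' : (u : ℝ) < 3 / 4 := by
    by_contra! h
    refine h1 (projIcc_of_right_le zero_le_one ?_)
    change (1 : ℝ) ≤ u + 1 * (u - 1 / 2)
    linarith
  exact le_min (by linarith) (by linarith)

/-- Coordinatewise expansion of the unit cube. -/
noncomputable def cubeExpand (n : ℕ) : C(I × (Fin n → I), Fin n → I) :=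
  ⟨fun p i => expand (p.1, p.2 i), by fun_prop⟩

/-- A function on the unit cube that vanishes on the boundary and is constant `1` on all points
that do not end up in the boundary after expansion. -/
noncomputable def cubePlateau (n : ℕ) : C(Fin n → I, I) :=
  ⟨fun y => ∏ i, plateau (y i), by fun_prop⟩

variable {n : ℕ}

theorem cubeExpand_zero (y : Fin n → I) : cubeExpand n (0, y) = y :=
  funext fun i => expand_zero (y i)

theorem cubeExpand_mem_boundary {y : Fin n → I} (t : I) (hy : y ∈ Cube.boundary (Fin n)) :
    cubeExpand n (t, y) ∈ Cube.boundary (Fin n) := by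
  obtain ⟨i, hi⟩ := hy
  refine ⟨i, ?_⟩
  rwa [show cubeExpand n (t, y) i = _ from expand_of_eq t hi]

theorem cubePlateau_of_mem_boundary {y : Fin n → I} (hy : y ∈ Cube.boundary (Fin n)) :
    cubePlateau n y = 0 := by
  obtain ⟨i, hi⟩ := hy
  exact Finset.prod_eq_zero (Finset.mem_univ i) (plateau_of_eq hi)

theorem cubePlateau_eq_one {y : Fin n → I} (hy : cubeExpand n (1, y) ∉ Cube.boundary (Fin n)) :
    cubePlateau n y = 1 := by
  have h : ∀ i, plateau (y i) = 1 := fun i =>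
    plateau_eq_one (fun h => hy ⟨i, .inl h⟩) fun h => hy ⟨i, .inr h⟩
  change ∏ i, plateau (y i) = 1
  exact Finset.prod_eq_one fun i _ => h i

/-- If a generalized loop is freely deformed to a constant map, such that the deformation follows a
fixed loop on the boundary, then it is null-homotopic relative to the boundary. -/
theorem GenLoop.homotopic_const_of_free {X : Type*} [TopologicalSpace X] {x : X}
    (f : GenLoop (Fin n) X x) (H : C(I × (Fin n → I), X)) (γ : C(I, X)) (hγ : γ 0 = x)
    (hγ' : γ 1 = x) (H0 : ∀ y, H (0, y) = x) (H1 : ∀ y, H (1, y) = f y)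
    (Hb : ∀ t, ∀ y ∈ Cube.boundary (Fin n), H (t, y) = γ t) :
    GenLoop.Homotopic f GenLoop.const := by
  let ρ : C(Fin n → I, Fin n → I) := (cubeExpand n).comp ((ContinuousMap.const _ 1).prodMk (.id _))
  let f₁ : C(Fin n → I, X) := f.1.comp ρ
  let f₂ : C(Fin n → I, X) :=
    ⟨fun y => γ (unitInterval.symm (cubePlateau n y)), by fun_prop⟩
  have hf : ∀ y ∈ Cube.boundary (Fin n), f.1 y = x := f.2
  have h1 : f.1.HomotopicRel f₁ (Cube.boundary (Fin n)) :=
    ⟨{ toContinuousMap := f.1.comp (cubeExpand n)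
       map_zero_left := fun y => congrArg f (cubeExpand_zero y)
       map_one_left := fun y => rfl
       prop' := fun t y hy => (hf _ (cubeExpand_mem_boundary t hy)).trans (hf y hy).symm }⟩
  -- Run `H` backwards, slowed down by the plateau function so that nothing moves on the boundary.
  have h2 : f₁.HomotopicRel f₂ (Cube.boundary (Fin n)) := by
    refine ⟨{ toFun := fun p => H (unitInterval.symm (p.1 * cubePlateau n p.2), ρ p.2)
              continuous_toFun := by fun_prop
              map_zero_left := fun y => ?_
              map_one_left := fun y => ?_
              prop' := fun t y hy => ?_ }⟩
    · simp [H1, f₁]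
    · simp only [one_mul]
      -- Where `ρ y` is on the boundary, `H` follows `γ`; elsewhere the plateau value is `1`, and
      -- both sides equal `x`.
      by_cases hy : ρ y ∈ Cube.boundary (Fin n)
      · exact Hb _ _ hy
      · change _ = γ (unitInterval.symm (cubePlateau n y))
        rw [show cubePlateau n y = 1 from cubePlateau_eq_one hy, unitInterval.symm_one, H0, hγ]
    · simp [cubePlateau_of_mem_boundary hy, H1, f₁]
  -- `f₂` factors through the interval, so it can be slid along `γ` to the endpoint `γ 1 = x`.
  have h3 : f₂.HomotopicRel (GenLoop.const : GenLoop (Fin n) X x).1 (Cube.boundary (Fin n)) := by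
    refine ⟨{ toFun := fun p => γ (unitInterval.symm (unitInterval.symm p.1 * cubePlateau n p.2))
              continuous_toFun := by fun_prop
              map_zero_left := fun y => ?_
              map_one_left := fun y => ?_
              prop' := fun t y hy => ?_ }⟩
    · simp [f₂]
    · simp only [unitInterval.symm_one, zero_mul, unitInterval.symm_zero]
      exact hγ'
    · simp [f₂, cubePlateau_of_mem_boundary hy]
  exact (h1.trans h2).trans h3

end StretchedCube

/-! ### A global section forces asphericity. -/

namespace UniversalCovering

open scoped Topology

variable {X : Type u} {E : Type v} [TopologicalSpace E] {P : E → X} [TopologicalSpace X]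

theorem exists_lift_cube (hP : IsUniversalCovering P) {n : ℕ} (f : C(Fin n → I, X)) :
    ∃ g : C(Fin n → I, E), ∀ y, P (g y) = f y := by
  obtain ⟨e, he⟩ := hP.surjective (f 0)
  let H : C(I × (Fin n → I), X) := f.comp ⟨fun p i => p.1 * p.2 i, by fun_prop⟩
  have H0 : ∀ y, H (0, y) = P (ContinuousMap.const (Fin n → I) e y) := fun y =>
    (congrArg f (funext fun i => zero_mul (y i))).trans he.symm
  refine ⟨(hP.isCoveringMap.liftHomotopy H _ H0).comp
    ((ContinuousMap.const _ 1).prodMk (ContinuousMap.id _)), fun y => ?_⟩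
  refine (congrFun (hP.isCoveringMap.liftHomotopy_lifts H _ H0) (1, y)).trans ?_
  exact congrArg f (funext fun i => one_mul (y i))

/-- For `n ≥ 2` the boundary of the cube is path-connected, and a lift of a constant path is
constant. -/
theorem lift_eq_on_boundary (hP : IsUniversalCovering P) {n : ℕ} (hn : 2 ≤ n) {x : X}
    (g : C(Fin n → I, E)) (hg : ∀ y ∈ Cube.boundary (Fin n), P (g y) = x) :
    ∀ y ∈ Cube.boundary (Fin n), g y = g 0 := by
  have key : ∀ γ : C(I, Fin n → I), (∀ t, γ t ∈ Cube.boundary (Fin n)) → g (γ 0) = g (γ 1) := by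
    intro γ hγ
    refine hP.isCoveringMap.const_of_comp (g.comp γ).continuous (fun t t' => ?_) 0 1
    exact (hg _ (hγ t)).trans (hg _ (hγ t')).symm
  rintro y ⟨i, hi⟩
  have : Nontrivial (Fin n) := Fin.nontrivial_iff_two_le.2 hn
  obtain ⟨j, hj⟩ := exists_ne i
  -- Stay in the face of coordinate `i` while the others shrink to `0`; then coordinate `j` is `0`,
  -- so coordinate `i` can shrink as well.
  have h1 := key ⟨fun t k => if k = i then y i else unitInterval.symm t * y k,
    continuous_pi fun k => by split_ifs <;> fun_prop⟩ fun t => ⟨i, by simpa using hi⟩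
  have h2 := key ⟨fun t k => if k = i then unitInterval.symm t * y i else 0,
    continuous_pi fun k => by split_ifs <;> fun_prop⟩ fun t => ⟨j, by simp [hj]⟩
  convert h1.trans ?_ using 2
  · funext k
    by_cases hk : k = i <;> simp [hk]
  · convert h2 using 2
    · funext k
      by_cases hk : k = i <;> simp [hk]
    · funext k
      by_cases hk : k = i <;> simp [hk]

theorem subsingleton_pi_of_section (hP : IsUniversalCovering P)
    (s : C(BalancedProduct P, C(I, X))) (hs : ∀ z, pathProj hP (s z) = z) {n : ℕ} (hn : 2 ≤ n)
    (x : X) : Subsingleton (HomotopyGroup.Pi n X x) := by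
  have hend : ∀ a b, s (BalancedProduct.mk P a b) 0 = P a ∧ s (BalancedProduct.mk P a b) 1 = P b :=
    fun a b => by
      have := balancedProj_pathProj hP (s (BalancedProduct.mk P a b))
      rw [hs] at this
      exact ⟨(congrArg Prod.fst this).symm, (congrArg Prod.snd this).symm⟩
  have key : ∀ f : GenLoop (Fin n) X x, GenLoop.Homotopic f GenLoop.const := by
    intro f
    obtain ⟨g, hg⟩ := exists_lift_cube hP f.1
    have h0 : (0 : Fin n → I) ∈ Cube.boundary (Fin n) := ⟨⟨0, by lia⟩, .inl rfl⟩
    have hgb := lift_eq_on_boundary hP hn g fun y hy => (hg y).trans (f.2 y hy)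
    have hx : P (g 0) = x := (hg 0).trans (f.2 _ h0)
    have hc : Continuous fun y => s (BalancedProduct.mk P (g 0) (g y)) :=
      s.continuous.comp (BalancedProduct.continuous_mk.comp
        (f := fun y => (g 0, g y)) (by fun_prop))
    refine GenLoop.homotopic_const_of_free f
      ⟨fun p => s (BalancedProduct.mk P (g 0) (g p.2)) p.1,
        continuous_eval.comp ((hc.comp continuous_snd).prodMk continuous_fst)⟩
      (s (BalancedProduct.mk P (g 0) (g 0))) ((hend _ _).1.trans hx) ((hend _ _).2.trans hx)
      (fun y => (hend _ _).1.trans hx) (fun y => (hend _ _).2.trans (hg y)) fun t y hy => ?_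
    change s (BalancedProduct.mk P (g 0) (g y)) t = _
    rw [hgb y hy]
  refine ⟨fun f' g' => Quotient.inductionOn₂ f' g' fun f g => Quotient.sound ?_⟩
  exact (key f).trans (key g).symm

theorem secatTilde_eq_zero_iff {F : Type u} {B : Type v} {Y : Type w} [TopologicalSpace F]
    [TopologicalSpace B] [TopologicalSpace Y] (p : F → B) (q : B → Y) :
    secatTilde p q = 0 ↔ ∃ s : C(B, F), ∀ b, p (s b) = b := by
  constructor
  · intro h
    -- The infimum of the empty set is `⊤`, so the value `0` is attained, by a cover consisting of a
    -- single open set.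
    have hne : {n : ℕ∞ | ∃ k : ℕ, n = (k : ℕ∞) ∧ ∃ U : Fin (k + 1) → Set Y,
        (∀ i, IsOpen (U i)) ∧ (⋃ i, U i) = Set.univ ∧
        ∀ i, ∃ s : C(q ⁻¹' (U i), F), ∀ b : q ⁻¹' (U i), p (s b) = b}.Nonempty := by
      by_contra hne
      rw [secatTilde, Set.not_nonempty_iff_eq_empty.1 hne, sInf_empty] at h
      exact ENat.top_ne_zero h
    have hmem := csInf_mem hne
    rw [show sInf _ = (0 : ℕ∞) from h] at hmem
    obtain ⟨k, hk, U, -, hU, hs⟩ := hmem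
    obtain rfl : k = 0 := by exact_mod_cast hk.symm
    have hU0 : ∀ b, b ∈ q ⁻¹' (U 0) := fun b => by
      have hb : q b ∈ ⋃ i, U i := hU ▸ mem_univ _
      obtain ⟨i, hi⟩ := mem_iUnion.1 hb
      rwa [Fin.fin_one_eq_zero i] at hi
    obtain ⟨s, hs⟩ := hs 0
    exact ⟨s.comp ⟨fun b => ⟨b, hU0 b⟩, by fun_prop⟩, fun b => hs ⟨b, hU0 b⟩⟩
  · rintro ⟨s, hs⟩
    refine le_antisymm (sInf_le ⟨0, rfl, fun _ => univ, fun _ => isOpen_univ, iUnion_const _,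
      fun _ => ⟨s.comp ⟨Subtype.val, continuous_subtype_val⟩, fun b => hs b⟩⟩) zero_le

end UniversalCovering

theorem mainTheorem8 {X : Type u} [TopologicalSpace X] [T2Space X] [ConnectedSpace X]
    [Topology.CWComplex (Set.univ : Set X)]
    {E : Type v} [TopologicalSpace E] {P : E → X} (hP : IsUniversalCovering P) :
    (IsAspherical X ↔ UniversalCovering.tcTilde hP = 0) ∧
      (UniversalCovering.tcTilde hP = 0 ↔
        ∃ s : C(UniversalCovering.BalancedProduct P, C(I, X)),
          ∀ b, UniversalCovering.pathProj hP (s b) = b) := by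
  have hsec : UniversalCovering.tcTilde hP = 0 ↔
      ∃ s : C(UniversalCovering.BalancedProduct P, C(I, X)),
        ∀ b, UniversalCovering.pathProj hP (s b) = b :=
    UniversalCovering.secatTilde_eq_zero_iff _ _
  refine ⟨Iff.trans ⟨fun h => ?_, fun ⟨s, hs⟩ => ⟨?_, fun n hn x => ?_⟩⟩ hsec.symm, hsec⟩
  · have hK := CellSystem.isWeak_ofCWComplex X
    have := hK.locallyPathConnectedSpace
    exact UniversalCovering.exists_section_of_subsingleton_pi hP
      (fun n e => hP.subsingleton_pi h.2 n e) hK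
  · have := hP.simplyConnected
    exact hP.surjective.pathConnectedSpace hP.isCoveringMap.continuous
  · exact UniversalCovering.subsingleton_pi_of_section hP s hs hn x
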